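/- **Kähler potentials from $D_n$-Toda fields.** Let $n\ge 3$, let $K$ be the Cartan matrix of $D_n$ (nodes $n-1$ and $n$ both attached to $n-2$), and let $E_{\pm 1},\dots,E_{\pm n}$ be the Chevalley generators. *Fermionic realizations.* Let $\flat_A,\flat_A^+$, $A\in\{\pm1,\dots,\pm n\}$, be fermionic annihilation and creation operators on the Fock space with vacuum $|0\rangle$. In the bosonic realization, $E_{j}=\flat^+_j\flat_{j+1}-\flat^+_{-j-1}\flat_{-j}$ and $E_{-j}=\flat^+_{j+1}\flat_j-\flat^+_{-j}\flat_{-j-1}$ for $j<n$, $E_n=\flat^+_{n-1}\flat_{-n}-\flat^+_n\flat_{-n+1}$, $E_{-n}=\flat^+_{-n}\flat_{n-1}-\flat^+_{-n+1}\flat_n$, and $|\lambda_p\rangle=\flat_p^+\cdots\flat_1^+|0\rangle$ for $p\le n-2$. Put $c_\ell=(\flat_\ell+\flat^+_{-\ell})/\sqrt2$, $c^+_\ell=(\flat^+_\ell+\flat_{-\ell})/\sqrt2$ $(1\le\ell\le n)$ and $|0\rangle^{(1/2)}=\flat^+_{-n}\cdots\flat^+_{-1}|0\rangle$. In the half-spin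 realization, $E_j=c_j^+c_{j+1}$, $E_{-j}=c^+_{j+1}c_j$ for $j<n$, $E_n=c^+_{n-1}c^+_n$, $E_{-n}=c_nc_{n-1}$, and $|\lambda_p\rangle=c_p^+\cdots c_1^+|0\rangle^{(1/2)}$ for $p=n-1,n$. *Toda fields.* Let $U,V\subset\mathbb C$ be open and star-shaped about $z_0$, $\bar z_0$; here $\bar z\in V$ is treated as a variable independent of $z\in U$, and the geometric case is $V=\overline U$ with $\bar z$ the complex conjugate of $z$. Let $s_1,\dots,s_n$ on $U$ and $\bar s_1,\dots,\bar s_n$ on $V$ be nowhere vanishing holomorphic screening functions with chosen logarithms, and put $\xi_k=\sum_j(K^{-1})_{kj}\ln s_j$, $\bar\xi_k=\sum_j(K^{-1})_{kj}\ln\bar s_j$. In each of the two realizations let $M$ and $\bar M^{-1}$ solve $\frac{dM}{dz}=M\sum_js_jE_{-j}$, $\frac{d\bar M^{-1}}{d\bar z}=\big(\sum_j\bar s_jE_{j}\big)\bar M^{-1}$, with value $1$ at $z_0$, $\bar z_0$. The Toda fields $\Phi_1,\dots,\Phi_n$ are holomorphic functions of $(z,\bar z)$ on an open set $W\subset U\times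 V$ with $$e^{-\Phi_k}=\langle\lambda_k|\bar M^{-1}(\bar z)M(z)|\lambda_k\rangle\,e^{-\bar\xi_k(\bar z)-\xi_k(z)} .$$ (This is the form of the general solution of the Toda equations $\partial\bar\partial\Phi_k=-\exp\sum_jK_{kj}\Phi_j$.) *Surfaces.* Write $(i_1,\dots,i_r)=\int_{z_0}^zdx_1\,s_{i_1}(x_1)\int_{z_0}^{x_1}dx_2\,s_{i_2}(x_2)\cdots\int_{z_0}^{x_{r-1}}dx_r\,s_{i_r}(x_r)$ and put $f^A=e^{-\xi_1}F^A$, with $F^k=(1,2,\dots,k-1)$ for $1\le k\le n$, $F^{-n}=(1,\dots,n-2,n)$, and, for $1\le\ell\le n-1$, $$F^{-\ell}=(-1)^{n-\ell}\big[(1,\dots,n-2,n-1,n,n-2,\dots,\ell)+(1,\dots,n-2,n,n-1,n-2,\dots,\ell)\big].$$ Define $\bar f^A$ in the same way from $\bar s_j$ and $\bar z_0$. Let $\Theta_{pq}=\sum_{A>0}f^{(p)A}f^{(q)\,-A}$ for $0\le p,q\le n-1$; where $\Theta$ is invertible let $f_\parallel^A=\sum_q(\Theta^{-1})_{q,n-1}f^{(q)A}$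 for $A<0$ and $f_\parallel^A=0$ for $A>0$; define $\bar\Theta$, $\bar f_\parallel$ similarly. For $p=1,\dots,n$ the surface $\Sigma^{[p]}$ is given by the coordinates $X^{[p]\alpha,A}=f^{(\alpha-1)A}-\delta_{\alpha,n}f_\parallel^A$, $\bar X^{[p]\alpha,A}=\bar f^{(\alpha-1)A}-\delta_{\alpha,n}\bar f_\parallel^A$, $1\le\alpha\le p$. The ambient Kähler potential is $$\mathcal K^{[p]}(X,\bar X)=\ln\langle0|\bar X^{1}\cdots\bar X^{p}X^{p}\cdots X^{1}|0\rangle,$$ where for $p\le n-2$ $X^\alpha=\sum_AX^{\alpha,A}\flat_A^+$, $\bar X^\alpha=\sum_A\bar X^{\alpha,A}\flat_A$, and for $p=n-1,n$ the vacuum is $|0\rangle^{(1/2)}$ and $X^\alpha=\sum_{A>0}(X^{\alpha,A}c_A^++X^{\alpha,-A}c_A)$, $\bar X^\alpha=\sum_{A>0}(\bar X^{\alpha,A}c_A+\bar X^{\alpha,-A}c_A^+)$. The intrinsic metric $g^{[p]}_{z\bar z}$ of $\Sigma^{[p]}$ is the pullback by $(z,\bar z)\mapsto(X^{[p]}(z),\bar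 X^{[p]}(\bar z))$ of the metric $\partial_X\partial_{\bar X}\mathcal K^{[p]}$. *Claim.* At every point of $W$ (for $p=n$: at every point of $W$ where $\Theta$ and $\bar\Theta$ are invertible), for every $p=1,\dots,n$ the intrinsic metric of $\Sigma^{[p]}$ is derived from the Kähler potential $-\Phi_p$, that is, $g^{[p]}_{z\bar z}=\partial\bar\partial(-\Phi_p)$. More precisely, up to the choice of branch of the logarithm, on the surface $$\mathcal K^{[p]}=-\Phi_p\quad(p\le n-2),\qquad \mathcal K^{[p]}=-(\Phi_p+\xi_n+\bar\xi_n)\quad(p=n-1,\,n),$$ and the chiral terms do not change the metric: $\partial\bar\partial\big(-(\Phi_p+\xi_n+\bar\xi_n)\big)=\partial\bar\partial(-\Phi_p)$. -/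

import Mathlib

noncomputable section

namespace DToda

/-! ### Fermionic Fock space with `2n` oscillators

`Sum.inl i` stands for the label `+(i+1)` and `Sum.inr i` for the label `-(i+1)`, `i : Fin n`. -/

/-- The labels `±1, …, ±n`. -/
abbrev Idx (n : ℕ) : Type := Fin n ⊕ Fin n

/-- The Fock space: the exterior algebra on one generator for each label. -/
abbrev Fock (n : ℕ) : Type := ExteriorAlgebra ℂ (Idx n → ℂ)

/-- Linear operators on the Fock space. -/
abbrev Op (n : ℕ) : Type := Module.End ℂ (Fock n)

/-- The creation operator `♭⁺_A`: exterior multiplication by the generator with label `A`. -/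
def cre {n : ℕ} (A : Idx n) : Op n :=
  LinearMap.mulLeft ℂ (ExteriorAlgebra.ι ℂ (Pi.single A (1 : ℂ)))

/-- The annihilation operator `♭_A`: contraction with the coordinate functional of label `A`. -/
def ann {n : ℕ} (A : Idx n) : Op n :=
  CliffordAlgebra.contractLeft (LinearMap.proj A)

/-- The vacuum expectation value `⟨0| O |0⟩`; the vacuum `|0⟩` is `1` and the dual vacuum `⟨0|`
is the projection to degree zero. -/
def vev {n : ℕ} (O : Op n) : ℂ := ExteriorAlgebra.algebraMapInv (O 1)

/-- The operator `♭⁺_{-n} ⋯ ♭⁺_{-1}`, which takes `|0⟩` to the vacuum `|0⟩^{(1/2)}`. -/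
def halfKet (n : ℕ) : Op n := (List.ofFn fun i : Fin n => (cre (Sum.inr i) : Op n)).reverse.prod

/-- The operator `♭_{-1} ⋯ ♭_{-n}`, through which `⟨0|` gives the dual vacuum of `|0⟩^{(1/2)}`. -/
def halfBra (n : ℕ) : Op n := (List.ofFn fun i : Fin n => (ann (Sum.inr i) : Op n)).prod

/-- The expectation value of an operator in the vacuum `|0⟩^{(1/2)}` of the `c`-oscillators. -/
def halfVev {n : ℕ} (O : Op n) : ℂ := vev (halfBra n * O * halfKet n)

/-- The oscillator `c_ℓ = (♭_ℓ + ♭⁺_{-ℓ}) / √2`. -/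
def cAnn {n : ℕ} (i : Fin n) : Op n :=
  ((Real.sqrt 2 : ℝ) : ℂ)⁻¹ • (ann (Sum.inl i) + cre (Sum.inr i))

/-- The oscillator `c⁺_ℓ = (♭⁺_ℓ + ♭_{-ℓ}) / √2`. -/
def cCre {n : ℕ} (i : Fin n) : Op n :=
  ((Real.sqrt 2 : ℝ) : ℂ)⁻¹ • (cre (Sum.inl i) + ann (Sum.inr i))

/-! ### Chevalley generators of `D_n` -/

/-- The index before `i` (used only for the last simple root). -/
def prev {n : ℕ} (i : Fin n) : Fin n := ⟨i.val - 1, lt_of_le_of_lt (Nat.sub_le _ _) i.isLt⟩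

/-- Bosonic realization of `E_{+j}`: for `j < n` it is `♭⁺_j ♭_{j+1} - ♭⁺_{-j-1} ♭_{-j}`, and
`E_{+n} = ♭⁺_{n-1} ♭_{-n} - ♭⁺_n ♭_{-(n-1)}`. -/
def raiseB {n : ℕ} (i : Fin n) : Op n :=
  if h : i.val + 1 < n then
    cre (Sum.inl i) * ann (Sum.inl ⟨i.val + 1, h⟩)
      - cre (Sum.inr ⟨i.val + 1, h⟩) * ann (Sum.inr i)
  else
    cre (Sum.inl (prev i)) * ann (Sum.inr i) - cre (Sum.inl i) * ann (Sum.inr (prev i))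

/-- Bosonic realization of `E_{-j}`: for `j < n` it is `♭⁺_{j+1} ♭_j - ♭⁺_{-j} ♭_{-j-1}`, and
`E_{-n} = ♭⁺_{-n} ♭_{n-1} - ♭⁺_{-(n-1)} ♭_n`. -/
def lowerB {n : ℕ} (i : Fin n) : Op n :=
  if h : i.val + 1 < n then
    cre (Sum.inl ⟨i.val + 1, h⟩) * ann (Sum.inl i)
      - cre (Sum.inr i) * ann (Sum.inr ⟨i.val + 1, h⟩)
  else
    cre (Sum.inr i) * ann (Sum.inl (prev i)) - cre (Sum.inr (prev i)) * ann (Sum.inl i)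

/-- Half-spin realization of `E_{+j}`: `c⁺_j c_{j+1}` for `j < n`, and `c⁺_{n-1} c⁺_n`. -/
def raiseH {n : ℕ} (i : Fin n) : Op n :=
  if h : i.val + 1 < n then cCre i * cAnn ⟨i.val + 1, h⟩ else cCre (prev i) * cCre i

/-- Half-spin realization of `E_{-j}`: `c⁺_{j+1} c_j` for `j < n`, and `c_n c_{n-1}`. -/
def lowerH {n : ℕ} (i : Fin n) : Op n :=
  if h : i.val + 1 < n then cCre ⟨i.val + 1, h⟩ * cAnn i else cAnn i * cAnn (prev i)

/-! ### Screening functions and Toda fields -/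

/-- Nowhere vanishing holomorphic screening functions `s_1, …, s_n` on `U`, with a choice of
holomorphic logarithms. -/
structure Screening (n : ℕ) (U : Set ℂ) where
  /-- the screening functions -/
  s : Fin n → ℂ → ℂ
  /-- the chosen branches of `ln s_j` -/
  logS : Fin n → ℂ → ℂ
  logS_holo : ∀ j, DifferentiableOn ℂ (logS j) U
  exp_logS : ∀ j, ∀ z ∈ U, Complex.exp (logS j z) = s j z

/-- `ξ_k = ∑_j (K⁻¹)_{kj} ln s_j`, with `K` the Cartan matrix of `D_n`. -/
def xi {n : ℕ} {U : Set ℂ} (S : Screening n U) (k : Fin n) (z : ℂ) : ℂ :=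
  ∑ j, ((CartanMatrix.D n).map (Int.cast : ℤ → ℂ))⁻¹ k j * S.logS j z

/-- `M` is the solution on `U` of `dM/dz = M · ∑_j s_j(z) E_j` with `M(z₀) = 1`. The derivative of
an operator valued function on the finite-dimensional Fock space is taken in all matrix
elements. -/
def SolvesRight {n : ℕ} (U : Set ℂ) (z₀ : ℂ) (s : Fin n → ℂ → ℂ) (E : Fin n → Op n)
    (M : ℂ → Op n) : Prop :=
  M z₀ = 1 ∧ ∀ z ∈ U, ∀ (φ : Module.Dual ℂ (Fock n)) (ψ : Fock n),
    HasDerivAt (fun ζ => φ (M ζ ψ)) (φ ((M z * ∑ j, s j z • E j) ψ)) z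

/-- `N` is the solution on `V` of `dN/dw = (∑_j s_j(w) E_j) · N` with `N(w₀) = 1`. -/
def SolvesLeft {n : ℕ} (V : Set ℂ) (w₀ : ℂ) (s : Fin n → ℂ → ℂ) (E : Fin n → Op n)
    (N : ℂ → Op n) : Prop :=
  N w₀ = 1 ∧ ∀ w ∈ V, ∀ (φ : Module.Dual ℂ (Fock n)) (ψ : Fock n),
    HasDerivAt (fun ζ => φ (N ζ ψ)) (φ (((∑ j, s j w • E j) * N w) ψ)) w

/-- The first `k + 1` positive labels. -/
def low {n : ℕ} (k : Fin n) (a : Fin (k.val + 1)) : Fin n :=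
  ⟨a.val, lt_of_lt_of_le a.isLt k.isLt⟩

/-- The highest weight matrix element `⟨λ_p| M̄⁻¹ M |λ_p⟩`, `p = k + 1`, where `N = M̄⁻¹`.
For `p ≤ n - 2` the state is `♭⁺_p ⋯ ♭⁺_1 |0⟩` and the operators `N`, `M` of the bosonic realization
act; for `p = n - 1, n` the state is `c⁺_p ⋯ c⁺_1 |0⟩^{(1/2)}` and those of the half-spin realization,
`Nh`, `Mh`, act. -/
def tau {n : ℕ} (N M Nh Mh : Op n) (k : Fin n) : ℂ :=
  if k.val + 3 ≤ n then
    vev ((List.ofFn fun a => (ann (Sum.inl (low k a)) : Op n)).prod * (N * M)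
      * (List.ofFn fun a => (cre (Sum.inl (low k a)) : Op n)).reverse.prod)
  else
    halfVev ((List.ofFn fun a => (cAnn (low k a) : Op n)).prod * (Nh * Mh)
      * (List.ofFn fun a => (cCre (low k a) : Op n)).reverse.prod)

/-- `Φ_1, …, Φ_n` are the `D_n`-Toda fields on `W` with screening functions `s_j(z)` (those of `S`) and
`s̄_j(z̄)` (those of `T`; the independent variable `w` stands for `z̄`): the holomorphic functions
defined by `e^{-Φ_k} = ⟨λ_k| M̄⁻¹(z̄) M(z) |λ_k⟩ e^{-ξ̄_k(z̄) - ξ_k(z)}`, where `M` and `N = M̄⁻¹` solve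
`dM/dz = M ∑_j s_j E_{-j}`, `dN/dz̄ = (∑_j s̄_j E_{+j}) N`, with the value `1` at the base points, in the
bosonic realization (`M`, `N`) and in the half-spin realization (`Mh`, `Nh`). -/
def IsTodaFields {n : ℕ} {U V : Set ℂ} (S : Screening n U) (T : Screening n V) (z₀ w₀ : ℂ)
    (W : Set (ℂ × ℂ)) (Φ : Fin n → ℂ → ℂ → ℂ) : Prop :=
  (∀ k, DifferentiableOn ℂ (fun q : ℂ × ℂ => Φ k q.1 q.2) W) ∧
  ∃ M Mh N Nh : ℂ → Op n,
    SolvesRight U z₀ S.s lowerB M ∧ SolvesRight U z₀ S.s lowerH Mh ∧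
    SolvesLeft V w₀ T.s raiseB N ∧ SolvesLeft V w₀ T.s raiseH Nh ∧
    ∀ k, ∀ z w, (z, w) ∈ W →
      Complex.exp (-Φ k z w)
        = tau (N w) (M z) (Nh w) (Mh z) k * Complex.exp (-xi T k w - xi S k z)

/-! ### The surfaces -/

/-- The integral of `g` from `z₀` to `z`, along the straight segment. -/
def segInt (z₀ : ℂ) (g : ℂ → ℂ) (z : ℂ) : ℂ :=
  ∫ t in (0 : ℝ)..1, g (z₀ + (t : ℂ) * (z - z₀)) * (z - z₀)

/-- The repeated integral
`(i₁, i₂, …, i_r) = ∫_{z₀}^z dx₁ s_{i₁}(x₁) ∫_{z₀}^{x₁} dx₂ s_{i₂}(x₂) ⋯`. -/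
def iterInt {n : ℕ} (s : Fin n → ℂ → ℂ) (z₀ : ℂ) : List (Fin n) → ℂ → ℂ
  | [] => fun _ => 1
  | i :: l => segInt z₀ fun x => s i x * iterInt s z₀ l x

/-- The functions `F^A`: `F^k = (1, …, k-1)` for `1 ≤ k ≤ n`, `F^{-n} = (1, …, n-2, n)`, and
`F^{-ℓ} = (-1)^{n-ℓ} [(1, …, n-2, n-1, n, n-2, …, ℓ) + (1, …, n-2, n, n-1, n-2, …, ℓ)]`
for `ℓ ≤ n - 1`. -/
def bigF {n : ℕ} (s : Fin n → ℂ → ℂ) (z₀ : ℂ) : Idx n → ℂ → ℂ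
  | Sum.inl i => iterInt s z₀ ((List.finRange n).take i.val)
  | Sum.inr i =>
    let last : Fin n := ⟨n - 1, by have := i.isLt; omega⟩
    let penult : Fin n := ⟨n - 2, by have := i.isLt; omega⟩
    let head : List (Fin n) := (List.finRange n).take (n - 2)
    let tail : List (Fin n) := (head.drop i.val).reverse
    if i = last then iterInt s z₀ (head ++ [last])
    else fun z => (-1) ^ (n - 1 - i.val) *
      (iterInt s z₀ (head ++ [penult, last] ++ tail) z
        + iterInt s z₀ (head ++ [last, penult] ++ tail) z)

/-- The embedding functions `f^A = e^{-ξ_1} F^A` of the `W`-surface. -/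
def emb {n : ℕ} [NeZero n] {U : Set ℂ} (S : Screening n U) (z₀ : ℂ) (A : Idx n) (z : ℂ) : ℂ :=
  Complex.exp (-xi S 0 z) * bigF S.s z₀ A z

/-- `Θ_{pq} = ∑_{A>0} f^{(p) A} f^{(q) -A}`, `0 ≤ p, q ≤ n - 1`. -/
def Theta {n : ℕ} [NeZero n] {U : Set ℂ} (S : Screening n U) (z₀ z : ℂ) :
    Matrix (Fin n) (Fin n) ℂ :=
  Matrix.of fun p q => ∑ i : Fin n,
    iteratedDeriv p.val (emb S z₀ (Sum.inl i)) z * iteratedDeriv q.val (emb S z₀ (Sum.inr i)) z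

/-- The index `n` of the last node. -/
def lastIdx (n : ℕ) [NeZero n] : Fin n := ⟨n - 1, Nat.sub_lt (NeZero.pos n) one_pos⟩

/-- The vector `f_∥`: it has negative components only, `f_∥^A = ∑_q (Θ⁻¹)_{q, n-1} f^{(q) A}` for
`A < 0`, so that `∑_A f_∥^A f^{(p) -A} = δ_{p, n-1}` for `0 ≤ p ≤ n - 1`. -/
def fPar {n : ℕ} [NeZero n] {U : Set ℂ} (S : Screening n U) (z₀ : ℂ) : Idx n → ℂ → ℂ
  | Sum.inl _ => fun _ => 0
  | Sum.inr i => fun z =>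
      ∑ q : Fin n, (Theta S z₀ z)⁻¹ q (lastIdx n) * iteratedDeriv q.val (emb S z₀ (Sum.inr i)) z

/-- The surface `Σ^{[p]}`, `p = k + 1`: its coordinates are
`X^{[p] α} = (f, f', …, f^{(p-1)})`, where for `p = n` the last row is `f^{(n-1)} - f_∥`. -/
def surface {n : ℕ} [NeZero n] {U : Set ℂ} (S : Screening n U) (z₀ : ℂ) (k : Fin n) (z : ℂ) :
    Fin (k.val + 1) → Idx n → ℂ :=
  fun a A => iteratedDeriv a.val (emb S z₀ A) z - if a.val + 1 = n then fPar S z₀ A z else 0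

/-! ### Kähler potentials and intrinsic metrics -/

/-- `exp 𝒦^{[p]}`, `p = k + 1`, as a function of the coordinates `X^{α A}`, `X̄^{α A}`. For `p ≤ n - 2` it
is `⟨0| X̄^1 ⋯ X̄^p X^p ⋯ X^1 |0⟩` with `X^α = ∑_A X^{α A} ♭⁺_A`, `X̄^α = ∑_A X̄^{α A} ♭_A`; for
`p = n - 1, n` it is the same expression in the vacuum `|0⟩^{(1/2)}`, with
`X^α = ∑_{A>0} (X^{α A} c⁺_A + X^{α -A} c_A)`, `X̄^α = ∑_{A>0} (X̄^{α A} c_A + X̄^{α -A} c⁺_A)`. -/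
def expPotential {n : ℕ} (k : Fin n) (X Xb : Fin (k.val + 1) → Idx n → ℂ) : ℂ :=
  if k.val + 3 ≤ n then
    vev ((List.ofFn fun a => (∑ A, Xb a A • ann A : Op n)).prod
      * (List.ofFn fun a => (∑ A, X a A • cre A : Op n)).reverse.prod)
  else
    halfVev ((List.ofFn fun a =>
        (∑ i, (Xb a (Sum.inl i) • cAnn i + Xb a (Sum.inr i) • cCre i) : Op n)).prod
      * (List.ofFn fun a =>
        (∑ i, (X a (Sum.inl i) • cCre i + X a (Sum.inr i) • cAnn i) : Op n)).reverse.prod)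

/-- The Kähler metric `∑_{a,b} (∂² ln P / ∂X^a ∂X̄^b) u^a v^b` at `(X, X̄)`, evaluated on the holomorphic
vector `u` and the antiholomorphic vector `v`; written with logarithmic derivatives, so that no
branch of `ln P` has to be chosen. -/
def kahlerMetric {E : Type*} [AddCommGroup E] [Module ℂ E] (P : E → E → ℂ) (X Xb u v : E) : ℂ :=
  deriv (fun t : ℂ => logDeriv (fun r : ℂ => P (X + t • u) (Xb + r • v)) 0) 0

/-- The component `g_{z z̄}` of the intrinsic metric of `Σ^{[p]}`, `p = k + 1`: the pullback by
`(z, z̄) ↦ (X^{[p]}(z), X̄^{[p]}(z̄))` of the metric with potential `𝒦^{[p]}`; `w` stands for `z̄`. -/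
def intrinsicMetric {n : ℕ} [NeZero n] {U V : Set ℂ} (S : Screening n U) (T : Screening n V)
    (z₀ w₀ : ℂ) (k : Fin n) (z w : ℂ) : ℂ :=
  kahlerMetric (expPotential k) (surface S z₀ k z) (surface T w₀ k w)
    (deriv (surface S z₀ k) z) (deriv (surface T w₀ k) w)

/-- `∂ ∂̄ K` at `(z, w)`, with `w` standing for `z̄`. -/
def mixedDeriv (K : ℂ → ℂ → ℂ) (z w : ℂ) : ℂ :=
  deriv (fun ζ => deriv (fun ω => K ζ ω) w) z

end DToda

end

open DToda

/-!
The proof rests on the intertwining property of the transport operator `M`. If the oscillators `a_A`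
of a realization are rotated by `E_{-j}` through the matrix `Λ_j` of the vector representation, then
`M a_A = (∑_B m_{BA} a_B) M`, where `m` solves `dm/dz = m ∑_j s_j Λ_j`, because the difference of the
two sides solves a linear homogeneous equation (`Transport.intertwine`). As `M` fixes the vacuum, `M`
takes the highest weight vector `a_p ⋯ a_1 |0⟩` to the product of the fields of the columns
`m e_p, …, m e_1`. The first column of `m` is `F` (`VectorTransport.eq_bigF`), and differentiation moves
from each column to the next, so the rows `f, f', …` of a surface are triangular combinations of the
columns (`iteratedDeriv_emb`). A product of anticommuting operators only sees the diagonal of a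
triangular change of frame (`ket_triangular`), and the diagonal coefficients multiply to `e^{-ξ_p}`, or
to `e^{-ξ_p-ξ_n}` for `p = n - 1, n`, by the rows of the Cartan matrix (`prod_rowCoeff_eq_weight`).

For `p = n` the derivative `f^{(n-1)}` contains both `m e_n` and `m e_{-n}`. The matrix `m` is orthogonal
(`form_columns`) and `f^{(n-1)} - f_∥` is isotropic and orthogonal to the first `n - 1` columns, so only
one of the two survives. It is `m e_n`: with `m e_{-n}` the product of the rows would annihilate the
half-spin vacuum, but it is not zero, since the invertibility of `Θ` makes the positive parts of the
rows linearly independent (`ket_rows_ne_zero`, `row_last`).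

The dual Fock space with transposed operators is a representation of the same kind, with the
equation for `M̄⁻¹` in the place of that for `M`, so the bras need no separate argument (`FockRep`,
`braRep`). Pairing the two states gives `expPotential_surface`. The metrics are then compared by the
chain rule (`kahlerMetric_pullback`), which applies since the exponential of the potential is a finite
sum of products of a polynomial in `X` and a polynomial in `X̄`.
-/

noncomputable section

namespace DToda

/-! ### Representations of the canonical anticommutation relations -/

/-- A space `H` on which `2n` fermionic oscillators act, with a vacuum vector and a dual vacuum.
The Fock space and its dual, with transposed operators, are both of this kind, so that kets and bras
can be treated at once. -/
structure FockRep (n : ℕ) (H : Type) [AddCommGroup H] [Module ℂ H] where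
  /-- creation operators -/
  cr : Idx n → Module.End ℂ H
  /-- annihilation operators -/
  an : Idx n → Module.End ℂ H
  /-- the vacuum -/
  vac : H
  /-- the dual vacuum -/
  bra : Module.Dual ℂ H
  cr_cr : ∀ A B, cr A * cr B + cr B * cr A = 0
  an_an : ∀ A B, an A * an B + an B * an A = 0
  an_cr : ∀ A B, an A * cr B + cr B * an A = if A = B then 1 else 0
  an_vac : ∀ A, an A vac = 0
  bra_cr : ∀ A x, bra (cr A x) = 0
  bra_vac : bra vac = 1

theorem cre_apply {n : ℕ} (A : Idx n) (x : Fock n) :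
    cre A x = ExteriorAlgebra.ι ℂ (Pi.single A (1 : ℂ)) * x := rfl

theorem cre_cre {n : ℕ} (A B : Idx n) (x : Fock n) : cre A (cre B x) + cre B (cre A x) = 0 := by
  rw [cre_apply, cre_apply, cre_apply, cre_apply, ← mul_assoc, ← mul_assoc, ← add_mul,
    ExteriorAlgebra.ι_add_mul_swap, zero_mul]

theorem ann_ann {n : ℕ} (A B : Idx n) (x : Fock n) : ann A (ann B x) + ann B (ann A x) = 0 :=
  add_eq_zero_iff_eq_neg.2 (CliffordAlgebra.contractLeft_comm
    (Q := (0 : QuadraticForm ℂ (Idx n → ℂ))) (LinearMap.proj A) (LinearMap.proj B) x)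

theorem ann_cre {n : ℕ} (A B : Idx n) (x : Fock n) :
    ann A (cre B x) + cre B (ann A x) = if A = B then x else 0 := by
  have h : ann A (cre B x) = (Pi.single B (1 : ℂ) : Idx n → ℂ) A • x - cre B (ann A x) :=
    CliffordAlgebra.contractLeft_ι_mul (Q := (0 : QuadraticForm ℂ (Idx n → ℂ)))
      (LinearMap.proj A) (Pi.single B (1 : ℂ)) x
  rw [h, sub_add_cancel, Pi.single_apply]
  split_ifs <;> simp

theorem ann_one {n : ℕ} (A : Idx n) : ann A (1 : Fock n) = 0 :=
  CliffordAlgebra.contractLeft_one (Q := (0 : QuadraticForm ℂ (Idx n → ℂ))) (LinearMap.proj A)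

/-- The dual vacuum `⟨0|`. -/
def dualVac (n : ℕ) : Module.Dual ℂ (Fock n) :=
  (ExteriorAlgebra.algebraMapInv : Fock n →ₐ[ℂ] ℂ).toLinearMap

theorem dualVac_cre {n : ℕ} (A : Idx n) (x : Fock n) : dualVac n (cre A x) = 0 := by
  rw [cre_apply]
  simp [dualVac, ExteriorAlgebra.algebraMapInv]

theorem dualVac_one (n : ℕ) : dualVac n 1 = 1 := by simp [dualVac]

/-- The Fock space itself. -/
def ketRep (n : ℕ) : FockRep n (Fock n) where
  cr := cre
  an := ann
  vac := 1
  bra := dualVac n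
  cr_cr A B := LinearMap.ext fun x => cre_cre A B x
  an_an A B := LinearMap.ext fun x => ann_ann A B x
  an_cr A B := LinearMap.ext fun x => by
    refine (ann_cre A B x).trans ?_
    split_ifs <;> rfl
  an_vac := ann_one
  bra_cr := dualVac_cre
  bra_vac := dualVac_one n

/-- The transpose of an operator on the Fock space. -/
def transp {n : ℕ} (O : Op n) : Module.End ℂ (Module.Dual ℂ (Fock n)) :=
  Module.Dual.transpose (R := ℂ) O

theorem transp_apply {n : ℕ} (O : Op n) (φ : Module.Dual ℂ (Fock n)) (x : Fock n) :
    transp O φ x = φ (O x) := rfl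

/-- The dual of the Fock space: the transposed annihilation operators create, and the dual vacuum
`⟨0|` is the vacuum. -/
def braRep (n : ℕ) : FockRep n (Module.Dual ℂ (Fock n)) where
  cr A := transp (ann A)
  an A := transp (cre A)
  vac := dualVac n
  bra := Module.Dual.eval ℂ (Fock n) 1
  cr_cr A B := LinearMap.ext fun φ => LinearMap.ext fun x =>
    (map_add φ _ _).symm.trans ((congrArg φ (ann_ann B A x)).trans (map_zero φ))
  an_an A B := LinearMap.ext fun φ => LinearMap.ext fun x =>
    (map_add φ _ _).symm.trans ((congrArg φ (cre_cre B A x)).trans (map_zero φ))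
  an_cr A B := LinearMap.ext fun φ => LinearMap.ext fun x => by
    refine (map_add φ _ _).symm.trans ((congrArg φ (ann_cre B A x)).trans ?_)
    by_cases h : A = B
    · rw [if_pos h, if_pos h.symm]; rfl
    · rw [if_neg h, if_neg (Ne.symm h), map_zero]; rfl
  an_vac A := LinearMap.ext fun x => dualVac_cre A x
  bra_cr A φ := (congrArg φ (ann_one A)).trans (map_zero φ)
  bra_vac := dualVac_one n

/-- The matrix of the lowering operator `E_{-j}` in the vector representation. -/
def lowMat {n : ℕ} (i : Fin n) : Matrix (Idx n) (Idx n) ℂ :=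
  if h : i.val + 1 < n then
    Matrix.single (Sum.inl ⟨i.val + 1, h⟩) (Sum.inl i) 1
      - Matrix.single (Sum.inr i) (Sum.inr ⟨i.val + 1, h⟩) 1
  else
    Matrix.single (Sum.inr i) (Sum.inl (prev i)) 1 - Matrix.single (Sum.inr (prev i)) (Sum.inl i) 1

theorem sum_single_smul {ι E : Type*} [Fintype ι] [DecidableEq ι] [AddCommGroup E] [Module ℂ E]
    (P Q A : ι) (x : ι → E) :
    ∑ B, (Matrix.single P Q (1 : ℂ)) B A • x B = if Q = A then x P else 0 := by
  by_cases h : Q = A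
  · subst h
    rw [Finset.sum_eq_single P]
    · simp
    · intro B _ hB
      rw [Matrix.single_apply_of_row_ne (Ne.symm hB), zero_smul]
    · simp
  · rw [if_neg h]
    exact Finset.sum_eq_zero fun B _ => by rw [Matrix.single_apply_of_col_ne _ _ h, zero_smul]

namespace FockRep

variable {n : ℕ} {H : Type} [AddCommGroup H] [Module ℂ H] (R : FockRep n H)

/-- The oscillators of the half-spin realization: `c⁺_ℓ` for the label `ℓ` and `c_ℓ` for `-ℓ`. -/
def c : Idx n → Module.End ℂ H
  | Sum.inl i => ((Real.sqrt 2 : ℝ) : ℂ)⁻¹ • (R.cr (Sum.inl i) + R.an (Sum.inr i))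
  | Sum.inr i => ((Real.sqrt 2 : ℝ) : ℂ)⁻¹ • (R.an (Sum.inl i) + R.cr (Sum.inr i))

/-- The lowering operators `E_{-j}` in the bosonic realization. -/
def lowB (i : Fin n) : Module.End ℂ H :=
  if h : i.val + 1 < n then
    R.cr (Sum.inl ⟨i.val + 1, h⟩) * R.an (Sum.inl i)
      - R.cr (Sum.inr i) * R.an (Sum.inr ⟨i.val + 1, h⟩)
  else
    R.cr (Sum.inr i) * R.an (Sum.inl (prev i)) - R.cr (Sum.inr (prev i)) * R.an (Sum.inl i)

/-- The lowering operators `E_{-j}` in the half-spin realization. -/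
def lowH (i : Fin n) : Module.End ℂ H :=
  if h : i.val + 1 < n then R.c (Sum.inl ⟨i.val + 1, h⟩) * R.c (Sum.inr i)
  else R.c (Sum.inr i) * R.c (Sum.inr (prev i))

/-- The vacuum `|0⟩^{(1/2)}`. -/
def hvac : H := (List.ofFn fun i : Fin n => R.cr (Sum.inr i)).reverse.prod R.vac

theorem c_c (A B : Idx n) :
    R.c A * R.c B + R.c B * R.c A = if A = B.swap then 1 else 0 := by
  have h2 : (((Real.sqrt 2 : ℝ) : ℂ)⁻¹) * (((Real.sqrt 2 : ℝ) : ℂ)⁻¹) = 1 / 2 := by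
    rw [← mul_inv, ← Complex.ofReal_mul, Real.mul_self_sqrt (by norm_num)]; norm_num
  have key : ∀ (x y x' y' : Module.End ℂ H),
      (((Real.sqrt 2 : ℝ) : ℂ)⁻¹ • (x + y)) * (((Real.sqrt 2 : ℝ) : ℂ)⁻¹ • (x' + y'))
      + (((Real.sqrt 2 : ℝ) : ℂ)⁻¹ • (x' + y')) * (((Real.sqrt 2 : ℝ) : ℂ)⁻¹ • (x + y))
      = (1 / 2 : ℂ) • ((x * x' + x' * x) + (x * y' + y' * x) + (y * x' + x' * y)
        + (y * y' + y' * y)) := by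
    intro x y x' y'
    rw [smul_mul_smul_comm, smul_mul_smul_comm, h2, ← smul_add]
    congr 1
    noncomm_ring
  have ca : ∀ A B, R.cr A * R.an B + R.an B * R.cr A = if A = B then 1 else 0 := fun A B => by
    rw [add_comm, R.an_cr]; simp only [eq_comm]
  rcases A with i | i <;> rcases B with j | j <;> simp only [c] <;> rw [key] <;>
    simp only [R.cr_cr, R.an_an, R.an_cr, ca] <;> simp
  · split_ifs
    · rw [← add_smul]; norm_num
    · simp
  · split_ifs
    · rw [← add_smul]; norm_num
    · simp

/-- Both realizations of `E_{-j}` act on their oscillators by the matrix `lowMat j`. -/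
theorem lowB_comm (j : Fin n) (A : Idx n) :
    R.lowB j * R.cr A = R.cr A * R.lowB j + ∑ B, lowMat j B A • R.cr B := by
  have key : ∀ P Q, R.cr P * R.an Q * R.cr A
      = R.cr A * (R.cr P * R.an Q) + if Q = A then R.cr P else 0 := by
    intro P Q
    have h1 : R.an Q * R.cr A = (if Q = A then 1 else 0) - R.cr A * R.an Q :=
      eq_sub_of_add_eq (R.an_cr Q A)
    have h2 : R.cr P * R.cr A = - (R.cr A * R.cr P) := eq_neg_of_add_eq_zero_left (R.cr_cr P A)
    rw [mul_assoc, h1, mul_sub, ← mul_assoc, h2]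
    split_ifs <;> noncomm_ring
  unfold lowB lowMat
  split_ifs with h <;>
    simp only [Matrix.sub_apply, sub_smul, Finset.sum_sub_distrib, sum_single_smul, sub_mul, key,
      mul_sub] <;> abel

theorem lowH_comm (j : Fin n) (A : Idx n) :
    R.lowH j * R.c A = R.c A * R.lowH j + ∑ B, lowMat j B A • R.c B := by
  have key : ∀ P Q, R.c P * R.c Q * R.c A
      = R.c A * (R.c P * R.c Q) + ((if Q.swap = A then R.c P else 0)
        - if P.swap = A then R.c Q else 0) := by
    intro P Q
    have h : ∀ Q, R.c Q * R.c A = (if Q.swap = A then 1 else 0) - R.c A * R.c Q := fun Q => by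
      rw [eq_sub_iff_add_eq, R.c_c]
      congr 1
      rw [eq_iff_iff]
      constructor
      · rintro rfl; simp
      · rintro rfl; simp
    rw [mul_assoc, h, mul_sub, ← mul_assoc, h P]
    split_ifs <;> noncomm_ring
  unfold lowH lowMat
  split_ifs with h <;>
    simp only [Matrix.sub_apply, sub_smul, Finset.sum_sub_distrib, sum_single_smul, key,
      Sum.swap_inl, Sum.swap_inr] <;> rfl

theorem lowB_vac (j : Fin n) : R.lowB j R.vac = 0 := by
  unfold lowB
  split_ifs <;> simp [R.an_vac]

end FockRep

/-! ### Products of operators applied to a vacuum -/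

section Ket

variable {H : Type} [AddCommGroup H] [Module ℂ H]

/-- The vector `x_p ⋯ x_1 v`. -/
def ket {p : ℕ} (x : Fin p → Module.End ℂ H) (v : H) : H := (List.ofFn x).reverse.prod v

@[simp]
theorem ket_zero (x : Fin 0 → Module.End ℂ H) (v : H) : ket x v = v := by simp [ket]

theorem ket_succ {p : ℕ} (x : Fin (p + 1) → Module.End ℂ H) (v : H) :
    ket x v = x (Fin.last p) (ket (fun i : Fin p => x i.castSucc) v) := by
  simp only [ket, List.ofFn_succ', List.concat_eq_append, List.reverse_append,
    List.reverse_cons, List.reverse_nil, List.nil_append, List.singleton_append, List.prod_cons,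
    Module.End.mul_apply]

theorem anticomm_ket {p : ℕ} (y : Module.End ℂ H) (x : Fin p → Module.End ℂ H) (v : H)
    (h : ∀ i, y * x i + x i * y = 0) (hv : y v = 0) : y (ket x v) = 0 := by
  induction p with
  | zero => simpa using hv
  | succ p ih =>
    rw [ket_succ, ← Module.End.mul_apply, eq_neg_of_add_eq_zero_left (h _), LinearMap.neg_apply,
      Module.End.mul_apply, ih _ (fun i => h _), map_zero, neg_zero]

/-- Anticommuting operators which square to zero kill a product in which they occur. -/
theorem mem_ket {p : ℕ} (x : Fin p → Module.End ℂ H) (v : H)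
    (h : ∀ i j, x i * x j + x j * x i = 0) (j : Fin p) : x j (ket x v) = 0 := by
  induction p with
  | zero => exact j.elim0
  | succ p ih =>
    rw [ket_succ, ← Module.End.mul_apply]
    refine Fin.lastCases ?_ (fun j => ?_) j
    · have h0 : x (Fin.last p) * x (Fin.last p) = 0 := by
        have := h (Fin.last p) (Fin.last p)
        rw [← two_smul ℂ] at this
        exact (smul_eq_zero.1 this).resolve_left two_ne_zero
      rw [h0, LinearMap.zero_apply]
    · rw [eq_neg_of_add_eq_zero_left (h _ _), LinearMap.neg_apply, Module.End.mul_apply,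
        ih (fun i => x i.castSucc) (fun i j => h _ _), map_zero, neg_zero]

/-- A product of creation-like operators `x_i` applied to a vacuum does not vanish, if there are
annihilators `d_i` dual to the `x_i`. -/
theorem ket_ne_zero {p : ℕ} (x d : Fin p → Module.End ℂ H) (v : H) (hv : v ≠ 0)
    (h : ∀ i j, d i * x j + x j * d i = if i = j then 1 else 0) (hd : ∀ i, d i v = 0) :
    ket x v ≠ 0 := by
  induction p with
  | zero => simpa using hv
  | succ p ih =>
    intro h0
    refine ih (fun i => x i.castSucc) (fun i => d i.castSucc)
      (fun i j => by rw [h]; simp [Fin.ext_iff]) (fun i => hd _) ?_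
    have h1 : d (Fin.last p) * x (Fin.last p) = 1 - x (Fin.last p) * d (Fin.last p) := by
      rw [eq_sub_iff_add_eq, h, if_pos rfl]
    have h2 : d (Fin.last p) (ket (fun i : Fin p => x i.castSucc) v) = 0 :=
      anticomm_ket _ _ _ (fun i => by rw [h, if_neg (Fin.castSucc_lt_last i).ne']) (hd _)
    have h3 := congrArg (d (Fin.last p)) h0
    rw [ket_succ, ← Module.End.mul_apply, h1, LinearMap.sub_apply, Module.End.mul_apply, h2,
      map_zero, map_zero, sub_zero] at h3
    simpa using h3

end Ket

namespace FockRep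

variable {n : ℕ} {H : Type} [AddCommGroup H] [Module ℂ H] (R : FockRep n H)

theorem vac_ne_zero : R.vac ≠ 0 := by
  intro h
  have := R.bra_vac
  rw [h, map_zero] at this
  exact zero_ne_one this

theorem hvac_ne_zero : R.hvac ≠ 0 :=
  ket_ne_zero (fun i => R.cr (Sum.inr i)) (fun i => R.an (Sum.inr i)) R.vac R.vac_ne_zero
    (fun i j => by rw [R.an_cr]; simp) (fun i => R.an_vac _)

/-- The oscillators `c_ℓ` annihilate the half-spin vacuum. -/
theorem c_inr_hvac (i : Fin n) : R.c (Sum.inr i) R.hvac = 0 := by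
  have h1 : R.an (Sum.inl i) R.hvac = 0 :=
    anticomm_ket _ _ _ (fun j => by rw [R.an_cr, if_neg (by simp)]) (R.an_vac _)
  have h2 : R.cr (Sum.inr i) R.hvac = 0 :=
    mem_ket (fun j : Fin n => R.cr (Sum.inr j)) _ (fun j k => R.cr_cr _ _) i
  simp [c, h1, h2]

theorem lowH_hvac (j : Fin n) : R.lowH j R.hvac = 0 := by
  unfold lowH
  split_ifs <;> simp [R.c_inr_hvac]

end FockRep

/-! ### Linear differential equations on star-shaped domains -/

section ODE

variable {U : Set ℂ} {z₀ : ℂ}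

theorem segment_mem (hUs : StarConvex ℝ z₀ U) {z : ℂ} (hz : z ∈ U) {t : ℝ}
    (ht : t ∈ Set.Icc (0 : ℝ) 1) : z₀ + (t : ℂ) * (z - z₀) ∈ U := by
  simpa [mul_comm] using hUs.add_smul_sub_mem hz ht.1 ht.2

/-- A solution of a linear system which vanishes at the centre of a star-shaped domain is zero:
Grönwall's inequality along each segment. -/
theorem eq_zero_of_linear_ode {ι : Type*} [Fintype ι] (hUs : StarConvex ℝ z₀ U)
    (L : ℂ → ι → ι → ℂ) (hL : ∀ i j, ContinuousOn (fun z => L z i j) U) (d : ℂ → ι → ℂ)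
    (h0 : ∀ i, d z₀ i = 0)
    (hd : ∀ z ∈ U, ∀ i, HasDerivAt (fun ζ => d ζ i) (∑ j, L z i j * d z j) z) :
    ∀ z ∈ U, ∀ i, d z i = 0 := by
  intro z hz
  let γ : ℝ → ℂ := fun t => z₀ + (t : ℂ) * (z - z₀)
  have hγU : ∀ t ∈ Set.Icc (0 : ℝ) 1, γ t ∈ U := fun t ht => segment_mem hUs hz ht
  have hγc : Continuous γ := by fun_prop
  have hγd : ∀ t, HasDerivAt γ (z - z₀) t := fun t => by
    simpa [γ] using ((Complex.ofRealCLM.hasDerivAt (x := t)).mul_const (z - z₀)).const_add z₀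
  have hder : ∀ t ∈ Set.Icc (0 : ℝ) 1,
      HasDerivAt (fun t => d (γ t)) (fun i => (∑ j, L (γ t) i j * d (γ t) j) * (z - z₀)) t := by
    intro t ht
    rw [hasDerivAt_pi]
    intro i
    exact HasDerivAt.comp_of_eq t (hd _ (hγU t ht) i) (hγd t) rfl
  have hcont : ContinuousOn (fun t => ∑ i, ∑ j, ‖L (γ t) i j‖ * ‖z - z₀‖) (Set.Icc 0 1) :=
    continuousOn_finsetSum _ fun i _ => continuousOn_finsetSum _ fun j _ =>
      (((hL i j).comp hγc.continuousOn fun t ht => hγU t ht).norm).mul continuousOn_const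
  obtain ⟨K, hK⟩ := isCompact_Icc.exists_bound_of_continuousOn hcont
  have := eq_zero_of_abs_deriv_le_mul_abs_self_of_eq_zero_right (f := fun t => d (γ t)) (K := K)
    (a := 0) (b := 1) (fun t ht => (hder t ht).continuousAt.continuousWithinAt)
    (fun t ht => (hder t ⟨ht.1, ht.2.le⟩).hasDerivWithinAt) (by ext i; simp [γ, h0])
    (fun t ht => by
      have ht' : t ∈ Set.Icc (0 : ℝ) 1 := ⟨ht.1, ht.2.le⟩
      have hK0 : ∑ i, ∑ j, ‖L (γ t) i j‖ * ‖z - z₀‖ ≤ K := (Real.le_norm_self _).trans (hK t ht')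
      refine (pi_norm_le_iff_of_nonneg ?_).2 fun i => ?_
      · exact mul_nonneg ((norm_nonneg _).trans (hK t ht')) (norm_nonneg _)
      · calc ‖(∑ j, L (γ t) i j * d (γ t) j) * (z - z₀)‖
            ≤ (∑ j, ‖L (γ t) i j‖ * ‖d (γ t)‖) * ‖z - z₀‖ := by
              rw [norm_mul]
              refine mul_le_mul_of_nonneg_right ((norm_sum_le _ _).trans ?_) (norm_nonneg _)
              refine Finset.sum_le_sum fun j _ => ?_
              rw [norm_mul]
              exact mul_le_mul_of_nonneg_left (norm_le_pi_norm _ j) (norm_nonneg _)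
          _ = (∑ j, ‖L (γ t) i j‖ * ‖z - z₀‖) * ‖d (γ t)‖ := by
              rw [Finset.sum_mul, Finset.sum_mul]
              exact Finset.sum_congr rfl fun j _ => by ring
          _ ≤ K * ‖d (γ t)‖ := by
              refine mul_le_mul_of_nonneg_right (le_trans ?_ hK0) (norm_nonneg _)
              exact Finset.single_le_sum
                (f := fun i => ∑ j, ‖L (γ t) i j‖ * ‖z - z₀‖)
                (fun i _ => Finset.sum_nonneg fun j _ => by positivity) (Finset.mem_univ i))
    1 ⟨zero_le_one, le_rfl⟩
  intro i
  simpa [γ] using congrFun this i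

theorem eq_of_deriv_eq_zero (hUs : StarConvex ℝ z₀ U) {g : ℂ → ℂ}
    (hg : ∀ z ∈ U, HasDerivAt g 0 z) : ∀ z ∈ U, g z = g z₀ := by
  intro z hz
  have := eq_zero_of_linear_ode (ι := Unit) hUs (fun _ _ _ => 0) (fun _ _ => continuousOn_const)
    (fun z _ => g z - g z₀) (by simp) (fun z hz _ => by simpa using (hg z hz).sub_const (g z₀))
    z hz ()
  exact sub_eq_zero.1 this

end ODE

/-! ### The transport operator on products of oscillators -/

/-- `dM/dz = M ∑_j s_j E_j`, `M(z₀) = 1`, in all matrix elements, on an arbitrary space. -/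
def Transport {n : ℕ} {H : Type} [AddCommGroup H] [Module ℂ H] (U : Set ℂ) (z₀ : ℂ)
    (s : Fin n → ℂ → ℂ) (E : Fin n → Module.End ℂ H) (M : ℂ → Module.End ℂ H) : Prop :=
  M z₀ = 1 ∧ ∀ z ∈ U, ∀ (φ : Module.Dual ℂ H) (ψ : H),
    HasDerivAt (fun ζ => φ (M ζ ψ)) (φ ((M z * ∑ j, s j z • E j) ψ)) z

/-- The matrix `m` of the vector representation: `dm/dz = m ∑_j s_j Λ_j`, `m(z₀) = 1`, where `Λ_j`
is the matrix of `E_{-j}`. -/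
def VectorTransport {n : ℕ} (U : Set ℂ) (z₀ : ℂ) (s : Fin n → ℂ → ℂ)
    (m : ℂ → Matrix (Idx n) (Idx n) ℂ) : Prop :=
  m z₀ = 1 ∧ ∀ z ∈ U, ∀ A B,
    HasDerivAt (fun ζ => m ζ A B) (∑ j, s j z * ∑ C, lowMat j C B * m z A C) z

section Transport

variable {n : ℕ} {H : Type} [AddCommGroup H] [Module ℂ H] {U : Set ℂ} {z₀ : ℂ}
  {s : Fin n → ℂ → ℂ} {E : Fin n → Module.End ℂ H} {M : ℂ → Module.End ℂ H}

theorem Transport.apply_eq_self [FiniteDimensional ℂ H] (hM : Transport U z₀ s E M)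
    (hUs : StarConvex ℝ z₀ U)
    {v : H} (hv : ∀ j, E j v = 0) {z : ℂ} (hz : z ∈ U) : M z v = v := by
  refine (Module.forall_dual_apply_eq_zero_iff ℂ (M z v - v)).1 (fun φ => ?_) |> sub_eq_zero.1
  have := eq_of_deriv_eq_zero hUs (g := fun ζ => φ (M ζ v)) (fun ζ hζ => by
    convert hM.2 ζ hζ φ v using 1
    simp [LinearMap.sum_apply, hv]) z hz
  rw [map_sub, this, hM.1, Module.End.one_apply, sub_self]

/-- `M a_A M⁻¹ = ∑_B m_{BA} a_B` for oscillators `a_A` on which the `E_j` act by `Λ_j`. -/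
theorem Transport.intertwine [FiniteDimensional ℂ H] (hM : Transport U z₀ s E M)
    (hUs : StarConvex ℝ z₀ U) (hs : ∀ j, ContinuousOn (s j) U)
    {a : Idx n → Module.End ℂ H}
    (ha : ∀ j A, E j * a A = a A * E j + ∑ B, lowMat j B A • a B)
    {m : ℂ → Matrix (Idx n) (Idx n) ℂ} (hm : VectorTransport U z₀ s m) {z : ℂ} (hz : z ∈ U)
    (A : Idx n) (ψ : H) : M z (a A ψ) = ∑ B, m z B A • a B (M z ψ) := by
  let b := Module.finBasis ℂ H
  set D : ℂ → Idx n → H → H := fun z A ψ => M z (a A ψ) - ∑ B, m z B A • a B (M z ψ) with hD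
  suffices h : ∀ φ : Module.Dual ℂ H, ∀ i, φ (D z A (b i)) = 0 by
    have h1 : M z * a A = ∑ B, m z B A • (a B * M z) := by
      refine b.ext fun i => ?_
      have := (Module.forall_dual_apply_eq_zero_iff ℂ _).1 fun φ => h φ i
      simpa [LinearMap.sum_apply] using sub_eq_zero.1 this
    simpa [LinearMap.sum_apply] using LinearMap.congr_fun h1 ψ
  intro φ i
  have hadd : ∀ z A (c : Fin (Module.finrank ℂ H) → ℂ),
      φ (D z A (∑ k, c k • b k)) = ∑ k, c k * φ (D z A (b k)) := by
    intro z A c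
    have : ∀ ψ, D z A ψ = (M z * a A - ∑ B, m z B A • (a B * M z)) ψ := fun ψ => by
      simp [hD, LinearMap.sum_apply]
    simp only [this, map_sum, map_smul, smul_eq_mul]
  -- the defect `D` satisfies a linear equation
  have hder : ∀ z ∈ U, ∀ A ψ, HasDerivAt (fun ζ => φ (D ζ A ψ))
      (∑ B, (∑ j, s j z * lowMat j B A) * φ (D z B ψ)
        + φ (D z A ((∑ j, s j z • E j) ψ))) z := by
    intro z hz A ψ
    have h1 := hM.2 z hz φ (a A ψ)
    have h2 := HasDerivAt.fun_sum (u := Finset.univ) fun B (_ : B ∈ Finset.univ) =>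
      (hm.2 z hz B A).mul (hM.2 z hz (φ ∘ₗ a B) ψ)
    have hfun : (fun ζ => φ (D ζ A ψ)) = (fun ζ => φ (M ζ (a A ψ)))
        - fun ζ => ∑ B, ((fun ζ => m ζ B A) * fun ζ => (φ ∘ₗ a B) (M ζ ψ)) ζ := by
      ext ζ
      simp [hD]
    rw [hfun]
    refine (h1.sub h2).congr_deriv (Eq.symm ?_)
    · have e1 : (M z * ∑ j, s j z • E j) (a A ψ) = M z (a A ((∑ j, s j z • E j) ψ))
          + ∑ B, (∑ j, s j z * lowMat j B A) • M z (a B ψ) := by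
        have : (∑ j, s j z • E j) * a A
            = a A * (∑ j, s j z • E j) + ∑ B, (∑ j, s j z * lowMat j B A) • a B := by
          simp only [Finset.sum_mul, Finset.mul_sum, smul_mul_assoc, ha, smul_add,
            Finset.sum_add_distrib, mul_smul_comm, Finset.smul_sum, Finset.sum_smul, smul_smul]
          rw [Finset.sum_comm (γ := Fin n)]
        have := congrArg (M z) (LinearMap.congr_fun this ψ)
        simpa [LinearMap.sum_apply, Module.End.mul_apply] using this
      rw [e1]
      simp only [hD, map_sub, map_add, map_sum, map_smul, smul_eq_mul, Module.End.mul_apply,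
        LinearMap.comp_apply, mul_sub, Finset.sum_sub_distrib, Finset.sum_add_distrib]
      have e2 : ∑ B, (∑ j, s j z * lowMat j B A) * ∑ C, m z C B * φ (a C (M z ψ))
          = ∑ B, (∑ j, s j z * ∑ C, lowMat j C A * m z B C) * φ (a B (M z ψ)) := by
        simp only [Finset.mul_sum, Finset.sum_mul]
        rw [Finset.sum_comm]
        refine Finset.sum_congr rfl fun C _ => ?_
        rw [Finset.sum_comm]
        exact Finset.sum_congr rfl fun j _ => Finset.sum_congr rfl fun B _ => by ring
      rw [e2]
      ring
  have := eq_zero_of_linear_ode (ι := Idx n × Fin (Module.finrank ℂ H)) hUs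
    (fun z p q => (if p.2 = q.2 then ∑ j, s j z * lowMat j q.1 p.1 else 0)
      + if p.1 = q.1 then ∑ j, s j z * b.repr (E j (b p.2)) q.2 else 0)
    (fun p q => by
      refine ContinuousOn.add ?_ ?_
      · split_ifs
        · exact continuousOn_finsetSum _ fun j _ => (hs j).mul continuousOn_const
        · exact continuousOn_const
      · split_ifs
        · exact continuousOn_finsetSum _ fun j _ => (hs j).mul continuousOn_const
        · exact continuousOn_const)
    (fun z p => φ (D z p.1 (b p.2)))
    (fun p => by
      have : ∑ B, (1 : Matrix (Idx n) (Idx n) ℂ) B p.1 • a B (b p.2) = a p.1 (b p.2) := by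
        rw [Finset.sum_eq_single p.1] <;> simp +contextual
      simp only [hD, hM.1, hm.1, Module.End.one_apply, this, sub_self, map_zero])
    (fun z hz p => by
      convert hder z hz p.1 (b p.2) using 1
      rw [Fintype.sum_prod_type]
      simp only [add_mul, Finset.sum_add_distrib, ite_mul, zero_mul]
      congr 1
      · exact Finset.sum_congr rfl fun B _ => by simp
      · have : (∑ j, s j z • E j) (b p.2) = ∑ k, (∑ j, s j z * b.repr (E j (b p.2)) k) • b k := by
          simp only [LinearMap.sum_apply, LinearMap.smul_apply, Finset.sum_smul, mul_smul]
          rw [Finset.sum_comm]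
          refine Finset.sum_congr rfl fun j _ => ?_
          rw [← Finset.smul_sum, b.sum_repr]
        rw [this, hadd]
        simp)
    z hz (A, i)
  exact this

/-- `∑_A u_A a_A`. -/
def field (a : Idx n → Module.End ℂ H) (u : Idx n → ℂ) : Module.End ℂ H := ∑ A, u A • a A

theorem Transport.apply_ket [FiniteDimensional ℂ H] (hM : Transport U z₀ s E M)
    (hUs : StarConvex ℝ z₀ U) (hs : ∀ j, ContinuousOn (s j) U)
    {a : Idx n → Module.End ℂ H}
    (ha : ∀ j A, E j * a A = a A * E j + ∑ B, lowMat j B A • a B)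
    {m : ℂ → Matrix (Idx n) (Idx n) ℂ} (hm : VectorTransport U z₀ s m) {z : ℂ} (hz : z ∈ U)
    {v : H} (hv : ∀ j, E j v = 0) {p : ℕ} (A : Fin p → Idx n) :
    M z (ket (fun i => a (A i)) v) = ket (fun i => field a fun B => m z B (A i)) v := by
  induction p with
  | zero => simpa using hM.apply_eq_self hUs hv hz
  | succ p ih =>
    rw [ket_succ, hM.intertwine hUs hs ha hm hz, ket_succ, ih fun i => A i.castSucc]
    simp [field, LinearMap.sum_apply]

/-- The bosonic transport operator contains the vector representation in its one-particle block. -/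
theorem exists_vectorTransport (R : FockRep n H) (hM : Transport U z₀ s R.lowB M) :
    ∃ m, VectorTransport U z₀ s m := by
  refine ⟨fun z => Matrix.of fun A B => R.bra (R.an A (M z (R.cr B R.vac))), ?_, ?_⟩
  · ext A B
    have h1 : R.an A * R.cr B = (if A = B then 1 else 0) - R.cr B * R.an A :=
      eq_sub_of_add_eq (R.an_cr A B)
    change R.bra (R.an A (M z₀ (R.cr B R.vac))) = _
    rw [hM.1, Module.End.one_apply, ← Module.End.mul_apply, h1, Matrix.one_apply]
    split_ifs <;> simp [R.an_vac, R.bra_vac]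
  · intro z hz A B
    refine (hM.2 z hz (R.bra ∘ₗ R.an A) (R.cr B R.vac)).congr_deriv ?_
    have h : ∀ j, R.lowB j (R.cr B R.vac) = ∑ C, lowMat j C B • R.cr C R.vac := fun j => by
      rw [← Module.End.mul_apply, R.lowB_comm, LinearMap.add_apply, Module.End.mul_apply,
        R.lowB_vac, map_zero, zero_add, LinearMap.sum_apply]
      rfl
    simp only [Module.End.mul_apply, LinearMap.sum_apply, LinearMap.smul_apply, h, map_sum,
      map_smul, smul_eq_mul, LinearMap.comp_apply, Matrix.of_apply]

end Transport

/-! ### Finiteness of the Fock space -/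

instance finiteDimensional_fock (n : ℕ) : FiniteDimensional ℂ (Fock n) := by
  have h : (⊤ : Submodule ℂ (Fock n))
      = ⨆ i : Fin (Fintype.card (Idx n) + 1), (⋀[ℂ]^(i : ℕ) (Idx n → ℂ)) := by
    refine le_antisymm ?_ le_top
    rw [← ExteriorAlgebra.ιMulti_span, Submodule.span_le]
    rintro _ ⟨⟨k, v⟩, rfl⟩
    have hk : ExteriorAlgebra.ιMulti ℂ k v ∈ ⋀[ℂ]^k (Idx n → ℂ) :=
      ExteriorAlgebra.ιMulti_range ℂ k ⟨v, rfl⟩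
    by_cases h : k < Fintype.card (Idx n) + 1
    · exact Submodule.mem_iSup_of_mem (⟨k, h⟩ : Fin _) hk
    · have h0 : Module.finrank ℂ (⋀[ℂ]^k (Idx n → ℂ)) = 0 := by
        rw [exteriorPower.finrank_eq, Module.finrank_fintype_fun_eq_card]
        exact Nat.choose_eq_zero_of_lt (by omega)
      rw [Submodule.finrank_eq_zero] at h0
      rw [h0] at hk
      change ExteriorAlgebra.ιMulti ℂ k v ∈ _
      rw [(Submodule.mem_bot ℂ).1 hk]
      exact Submodule.zero_mem _
  refine ⟨?_⟩
  rw [h]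
  exact Submodule.fg_iSup _ fun i => Module.Finite.iff_fg.1 inferInstance

/-! ### Repeated integrals -/

section Integrals

variable {U : Set ℂ} {z₀ : ℂ}

theorem eq_of_hasDerivAt_eq (hUs : StarConvex ℝ z₀ U) {f g f' : ℂ → ℂ}
    (hf : ∀ z ∈ U, HasDerivAt f (f' z) z) (hg : ∀ z ∈ U, HasDerivAt g (f' z) z)
    (h0 : f z₀ = g z₀) : ∀ z ∈ U, f z = g z := by
  intro z hz
  have := eq_of_deriv_eq_zero hUs (g := fun z => f z - g z)
    (fun z hz => ((hf z hz).sub (hg z hz)).congr_deriv (sub_self _)) z hz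
  rwa [h0, sub_self, sub_eq_zero] at this

/-- On a star-shaped domain, integration along segments gives a primitive. -/
theorem hasDerivAt_segInt (hU : IsOpen U) (hUs : StarConvex ℝ z₀ U) {g : ℂ → ℂ}
    (hg : DifferentiableOn ℂ g U) {z : ℂ} (hz : z ∈ U) :
    HasDerivAt (segInt z₀ g) (g z) z := by
  obtain ⟨ε, hε, hB⟩ := Metric.nhds_basis_closedBall.mem_iff.1 (hU.mem_nhds hz)
  have hg' : ContinuousOn (deriv g) U := (hg.deriv hU).continuousOn
  let γ : ℂ → ℝ → ℂ := fun x t => z₀ + (t : ℂ) * (x - z₀)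
  have hγU : ∀ x ∈ U, ∀ t ∈ Set.Icc (0 : ℝ) 1, γ x t ∈ U := fun x hx t ht => segment_mem hUs hx ht
  have hγc : Continuous fun q : ℂ × ℝ => γ q.1 q.2 := by fun_prop
  let F' : ℂ → ℝ → ℂ := fun x t => (t : ℂ) * deriv g (γ x t) * (x - z₀) + g (γ x t)
  have hmaps : Set.MapsTo (fun q : ℂ × ℝ => γ q.1 q.2)
      (Metric.closedBall z ε ×ˢ Set.Icc (0 : ℝ) 1) U := fun q hq => hγU _ (hB hq.1) _ hq.2
  have hF'c : ContinuousOn (fun q : ℂ × ℝ => F' q.1 q.2)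
      (Metric.closedBall z ε ×ˢ Set.Icc (0 : ℝ) 1) := by
    refine ContinuousOn.add (ContinuousOn.mul (ContinuousOn.mul ?_ ?_) ?_) ?_
    · fun_prop
    · exact hg'.comp hγc.continuousOn hmaps
    · fun_prop
    · exact hg.continuousOn.comp hγc.continuousOn hmaps
  obtain ⟨K, hK⟩ := ((isCompact_closedBall z ε).prod isCompact_Icc).exists_bound_of_continuousOn hF'c
  have hFc : ∀ x ∈ U, ContinuousOn (fun t => g (γ x t) * (x - z₀)) (Set.Icc 0 1) := fun x hx =>
    (hg.continuousOn.comp (by fun_prop) fun t ht => hγU x hx t ht).mul continuousOn_const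
  have hI : Set.uIoc (0 : ℝ) 1 ⊆ Set.Icc 0 1 := by
    rw [Set.uIoc_of_le zero_le_one]; exact Set.Ioc_subset_Icc_self
  have hF'z : ContinuousOn (F' z) (Set.Icc 0 1) :=
    hF'c.comp (f := fun t : ℝ => (z, t)) (by fun_prop)
      fun t ht => ⟨Metric.mem_closedBall_self hε.le, ht⟩
  have key := intervalIntegral.hasDerivAt_integral_of_dominated_loc_of_deriv_le
    (μ := MeasureTheory.volume) (a := 0) (b := 1) (F := fun x t => g (γ x t) * (x - z₀)) (F' := F')
    (x₀ := z) (bound := fun _ => K) (Metric.closedBall_mem_nhds z hε)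
    (Filter.eventually_of_mem (hU.mem_nhds hz) fun x hx =>
      ((hFc x hx).mono hI).aestronglyMeasurable measurableSet_uIoc)
    (((hFc z hz).mono (by rw [Set.uIcc_of_le zero_le_one])).intervalIntegrable)
    ((hF'z.mono hI).aestronglyMeasurable measurableSet_uIoc)
    (Filter.Eventually.of_forall fun t ht x hx => hK (x, t) ⟨hx, hI ht⟩)
    intervalIntegrable_const
    (Filter.Eventually.of_forall fun t ht x hx => by
      have h1 : HasDerivAt (fun x => γ x t) (t : ℂ) x := by
        simpa [γ] using (((hasDerivAt_id x).sub_const z₀).const_mul (t : ℂ)).const_add z₀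
      have h2 := (hg.differentiableAt (hU.mem_nhds (hγU x (hB hx) t (hI ht)))).hasDerivAt
      have h3 := (h2.comp x h1).mul ((hasDerivAt_id x).sub_const z₀)
      refine h3.congr_deriv ?_
      simp only [F', Function.comp_apply, id]
      ring)
  refine key.2.congr_deriv ?_
  have h4 : ∀ t ∈ Set.uIcc (0 : ℝ) 1, HasDerivAt (fun t : ℝ => (t : ℂ) * g (γ z t)) (F' z t) t := by
    intro t ht
    rw [Set.uIcc_of_le zero_le_one] at ht
    have h1 : HasDerivAt (fun t : ℝ => (t : ℂ)) 1 t := Complex.ofRealCLM.hasDerivAt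
    have h2 : HasDerivAt (γ z) (z - z₀) t := by
      simpa [γ] using (h1.mul_const (z - z₀)).const_add z₀
    have h3 := (hg.differentiableAt (hU.mem_nhds (hγU z hz t ht))).hasDerivAt
    refine (h1.mul (h3.comp_of_eq t h2 rfl)).congr_deriv ?_
    simp only [F', Function.comp_apply]
    ring
  rw [intervalIntegral.integral_eq_sub_of_hasDerivAt h4
    ((hF'z.mono (by rw [Set.uIcc_of_le zero_le_one])).intervalIntegrable)]
  simp [γ]

variable {n : ℕ} {s : Fin n → ℂ → ℂ}

theorem iterInt_base (i : Fin n) (l : List (Fin n)) : iterInt s z₀ (i :: l) z₀ = 0 := by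
  simp [iterInt, segInt]

theorem differentiableOn_iterInt (hU : IsOpen U) (hUs : StarConvex ℝ z₀ U)
    (hs : ∀ j, DifferentiableOn ℂ (s j) U) (l : List (Fin n)) :
    DifferentiableOn ℂ (iterInt s z₀ l) U := by
  induction l with
  | nil => exact differentiableOn_const _
  | cons i l ih =>
    exact fun z hz => (hasDerivAt_segInt hU hUs
      ((hs i).mul ih) hz).differentiableAt.differentiableWithinAt

theorem hasDerivAt_iterInt (hU : IsOpen U) (hUs : StarConvex ℝ z₀ U)
    (hs : ∀ j, DifferentiableOn ℂ (s j) U) (i : Fin n) (l : List (Fin n)) {z : ℂ} (hz : z ∈ U) :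
    HasDerivAt (iterInt s z₀ (i :: l)) (s i z * iterInt s z₀ l z) z :=
  hasDerivAt_segInt hU hUs ((hs i).mul (differentiableOn_iterInt hU hUs hs l)) hz

end Integrals

/-! ### The vector representation in terms of repeated integrals -/

section Columns

variable {n : ℕ} {U : Set ℂ} {z₀ : ℂ} {s : Fin n → ℂ → ℂ} {m : ℂ → Matrix (Idx n) (Idx n) ℂ}

/-- The action of `Λ_j` on the columns. -/
theorem sum_lowMat_mul (j : Fin n) (B : Idx n) (x : Idx n → ℂ) :
    ∑ C, lowMat j C B * x C =
      if h : j.val + 1 < n then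
        (if Sum.inl j = B then x (Sum.inl ⟨j.val + 1, h⟩) else 0)
          - if Sum.inr ⟨j.val + 1, h⟩ = B then x (Sum.inr j) else 0
      else (if Sum.inl (prev j) = B then x (Sum.inr j) else 0)
          - if Sum.inl j = B then x (Sum.inr (prev j)) else 0 := by
  simp only [← smul_eq_mul]
  unfold lowMat
  split_ifs with h <;>
    simp only [Matrix.sub_apply, sub_smul, Finset.sum_sub_distrib, sum_single_smul, *, if_true,
      if_false]

theorem VectorTransport.inl (hm : VectorTransport U z₀ s m) {z : ℂ} (hz : z ∈ U) (A : Idx n) (i : ℕ)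
    (hi : i + 2 < n) :
    HasDerivAt (fun ζ => m ζ A (Sum.inl ⟨i, by omega⟩))
      (s ⟨i, by omega⟩ z * m z A (Sum.inl ⟨i + 1, by omega⟩)) z := by
  refine (hm.2 z hz A _).congr_deriv ?_
  simp only [sum_lowMat_mul]
  rw [Finset.sum_eq_single ⟨i, by omega⟩]
  · rw [dif_pos (by simp; omega)]; simp
  · intro j _ hj
    have := j.isLt
    simp only [ne_eq, Fin.ext_iff] at hj
    split_ifs <;> simp_all [Fin.ext_iff, prev]
    omega
  · simp

theorem VectorTransport.inl_penult (hm : VectorTransport U z₀ s m) {z : ℂ} (hz : z ∈ U) (A : Idx n)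
    (hn : 2 ≤ n) :
    HasDerivAt (fun ζ => m ζ A (Sum.inl ⟨n - 2, by omega⟩))
      (s ⟨n - 2, by omega⟩ z * m z A (Sum.inl ⟨n - 1, by omega⟩)
        + s ⟨n - 1, by omega⟩ z * m z A (Sum.inr ⟨n - 1, by omega⟩)) z := by
  refine (hm.2 z hz A _).congr_deriv ?_
  simp only [sum_lowMat_mul]
  rw [Finset.sum_eq_add (⟨n - 2, by omega⟩ : Fin n) ⟨n - 1, by omega⟩]
  · rw [dif_pos (by simp; omega), dif_neg (by simp; omega)]
    have h : n - 2 + 1 = n - 1 := by omega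
    have h' : n - 1 ≠ n - 2 := by omega
    simp [prev, Fin.ext_iff, h, h', show n - 1 - 1 = n - 2 by omega]
  · simp [Fin.ext_iff]; omega
  · rintro j - ⟨h1, h2⟩
    have := j.isLt
    simp only [ne_eq, Fin.ext_iff] at h1 h2
    split_ifs <;> simp_all [Fin.ext_iff, prev]
    omega
  · simp
  · simp

theorem VectorTransport.inl_last (hm : VectorTransport U z₀ s m) {z : ℂ} (hz : z ∈ U) (A : Idx n)
    (hn : 2 ≤ n) :
    HasDerivAt (fun ζ => m ζ A (Sum.inl ⟨n - 1, by omega⟩))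
      (-(s ⟨n - 1, by omega⟩ z * m z A (Sum.inr ⟨n - 2, by omega⟩))) z := by
  refine (hm.2 z hz A _).congr_deriv ?_
  simp only [sum_lowMat_mul]
  rw [Finset.sum_eq_single ⟨n - 1, by omega⟩]
  · rw [dif_neg (by simp; omega)]
    have h' : n - 2 ≠ n - 1 := by omega
    simp [prev, Fin.ext_iff, h', show n - 1 - 1 = n - 2 by omega]
  · intro j _ hj
    have := j.isLt
    simp only [ne_eq, Fin.ext_iff] at hj
    split_ifs <;> simp_all [Fin.ext_iff, prev]
    omega
  · simp

theorem VectorTransport.inr_zero (hm : VectorTransport U z₀ s m) {z : ℂ} (hz : z ∈ U) (A : Idx n)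
    (hn : 0 < n) : HasDerivAt (fun ζ => m ζ A (Sum.inr ⟨0, hn⟩)) 0 z := by
  refine (hm.2 z hz A _).congr_deriv ?_
  simp only [sum_lowMat_mul]
  refine Finset.sum_eq_zero fun j _ => ?_
  split_ifs <;> simp_all

theorem VectorTransport.inr_succ (hm : VectorTransport U z₀ s m) {z : ℂ} (hz : z ∈ U) (A : Idx n)
    (i : ℕ) (hi : i + 1 < n) :
    HasDerivAt (fun ζ => m ζ A (Sum.inr ⟨i + 1, hi⟩))
      (-(s ⟨i, by omega⟩ z * m z A (Sum.inr ⟨i, by omega⟩))) z := by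
  refine (hm.2 z hz A _).congr_deriv ?_
  simp only [sum_lowMat_mul]
  rw [Finset.sum_eq_single ⟨i, by omega⟩]
  · rw [dif_pos (by simpa using hi)]; simp
  · intro j _ hj
    simp only [ne_eq, Fin.ext_iff] at hj
    split_ifs <;> simp_all [Fin.ext_iff]
  · simp

/-- Climbing from the column `k` to the first column: `G l` is a combination of repeated integrals
whose outer indices are `l`. -/
theorem VectorTransport.climb (hm : VectorTransport U z₀ s m) (hUs : StarConvex ℝ z₀ U) (A : Idx n)
    (k : ℕ) (hk : k + 2 ≤ n) (G : List (Fin n) → ℂ → ℂ)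
    (hG : ∀ i l, ∀ z ∈ U, HasDerivAt (G (i :: l)) (s i z * G l z) z) (hG0 : ∀ i l, G (i :: l) z₀ = 0)
    (hA : ∀ j (hj : j < n), j < k → A ≠ Sum.inl ⟨j, hj⟩)
    (h : ∀ z ∈ U, m z A (Sum.inl ⟨k, by omega⟩) = G [] z) :
    ∀ z ∈ U, m z A (Sum.inl ⟨0, by omega⟩) = G ((List.finRange n).take k) z := by
  suffices H : ∀ d j, (hj : j + d = k) → ∀ z ∈ U,
      m z A (Sum.inl ⟨j, by omega⟩) = G (((List.finRange n).take k).drop j) z by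
    simpa using H k 0 (by omega)
  intro d
  induction d with
  | zero =>
    intro j hj z hz
    obtain rfl : j = k := by omega
    rw [List.drop_eq_nil_of_le (by simp), h z hz]
  | succ d ih =>
    intro j hj z hz
    have hjl : j < ((List.finRange n).take k).length := by simp; omega
    rw [List.drop_eq_getElem_cons hjl]
    refine eq_of_hasDerivAt_eq hUs (fun z hz => hm.inl hz A j (by omega)) (fun z hz => ?_) ?_ z hz
    · rw [ih (j + 1) (by omega) z hz]
      convert hG _ _ z hz using 2
      simp
    · rw [hG0, hm.1, Matrix.one_apply_ne (hA j _ (by omega))]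

theorem VectorTransport.inl_inr (hm : VectorTransport U z₀ s m) (hUs : StarConvex ℝ z₀ U)
    (k : Fin n) (j : ℕ) (hj : j < n) : ∀ z ∈ U, m z (Sum.inl k) (Sum.inr ⟨j, hj⟩) = 0 := by
  induction j with
  | zero =>
    intro z hz
    rw [eq_of_deriv_eq_zero hUs (fun z hz => hm.inr_zero hz _ hj) z hz, hm.1]
    simp
  | succ j ih =>
    intro z hz
    rw [eq_of_deriv_eq_zero hUs (g := fun z => m z (Sum.inl k) (Sum.inr ⟨j + 1, hj⟩))
      (fun z hz => (hm.inr_succ hz _ j hj).congr_deriv ?_) z hz, hm.1]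
    · simp
    · rw [ih (by omega) z hz]; simp

/-- The transport matrix is unitriangular. -/
theorem VectorTransport.inl_inl (hm : VectorTransport U z₀ s m) (hUs : StarConvex ℝ z₀ U)
    (hn : 2 ≤ n) (k : Fin n) (d j : ℕ) (hj : j + d + 1 = n) (hkj : k.val ≤ j) :
    ∀ z ∈ U, m z (Sum.inl k) (Sum.inl ⟨j, by omega⟩) = if k.val = j then 1 else 0 := by
  have h1 : ∀ j (hj : j < n), m z₀ (Sum.inl k) (Sum.inl ⟨j, hj⟩) = if k.val = j then 1 else 0 := by
    intro j hj
    rw [hm.1, Matrix.one_apply]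
    simp [Fin.ext_iff]
  induction d generalizing j with
  | zero =>
    intro z hz
    obtain rfl : j = n - 1 := by omega
    rw [eq_of_deriv_eq_zero hUs (g := fun z => m z (Sum.inl k) (Sum.inl ⟨n - 1, by omega⟩))
      (fun z hz => (hm.inl_last hz _ hn).congr_deriv ?_) z hz, h1]
    rw [hm.inl_inr hUs k _ _ z hz]; simp
  | succ d ih =>
    intro z hz
    rw [eq_of_deriv_eq_zero hUs (g := fun z => m z (Sum.inl k) (Sum.inl ⟨j, by omega⟩))
      (fun z hz => ?_) z hz, h1]
    have h2 := ih (j + 1) (by omega) (by omega) z hz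
    rw [if_neg (by omega)] at h2
    by_cases hjn : j + 2 < n
    · exact (hm.inl hz _ j hjn).congr_deriv (by rw [h2, mul_zero])
    · obtain rfl : j = n - 2 := by omega
      refine (hm.inl_penult hz _ hn).congr_deriv ?_
      rw [hm.inl_inr hUs k _ _ z hz]
      simp only [show n - 2 + 1 = n - 1 by omega] at h2
      rw [h2]; simp

theorem VectorTransport.inr_inr_of_lt (hm : VectorTransport U z₀ s m) (hUs : StarConvex ℝ z₀ U)
    (i : Fin n) (j : ℕ) (hj : j < n) (hij : j < i.val) :
    ∀ z ∈ U, m z (Sum.inr i) (Sum.inr ⟨j, hj⟩) = 0 := by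
  induction j with
  | zero =>
    intro z hz
    rw [eq_of_deriv_eq_zero hUs (fun z hz => hm.inr_zero hz _ hj) z hz, hm.1, Matrix.one_apply_ne]
    simp [Fin.ext_iff]; omega
  | succ j ih =>
    intro z hz
    rw [eq_of_deriv_eq_zero hUs (g := fun z => m z (Sum.inr i) (Sum.inr ⟨j + 1, hj⟩))
      (fun z hz => (hm.inr_succ hz _ j hj).congr_deriv ?_) z hz, hm.1, Matrix.one_apply_ne]
    · simp [Fin.ext_iff]; omega
    · rw [ih (by omega) (by omega) z hz]; simp

theorem drop_take_succ (i j : ℕ) (hij : i ≤ j) (hj : j < n) :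
    (((List.finRange n).take (j + 1)).drop i).reverse
      = ⟨j, hj⟩ :: (((List.finRange n).take j).drop i).reverse := by
  rw [List.take_add_one, List.drop_append_of_le_length (by simp; omega), List.reverse_append]
  simp [hj]

/-- The columns `-j` in the row `-i` collect the indices `j - 1, …, i`, with a sign for each. -/
theorem VectorTransport.inr_inr (hm : VectorTransport U z₀ s m) (hU : IsOpen U)
    (hUs : StarConvex ℝ z₀ U) (hs : ∀ j, DifferentiableOn ℂ (s j) U)
    (i : Fin n) (d j : ℕ) (hj : j < n) (hij : i.val + d = j) :
    ∀ z ∈ U, m z (Sum.inr i) (Sum.inr ⟨j, hj⟩)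
      = (-1) ^ d * iterInt s z₀ (((List.finRange n).take j).drop i.val).reverse z := by
  induction d generalizing j with
  | zero =>
    intro z hz
    obtain rfl : i.val = j := by omega
    rw [List.drop_eq_nil_of_le (by simp)]
    have h0 : ∀ z ∈ U, HasDerivAt (fun z => m z (Sum.inr i) (Sum.inr i)) 0 z := by
      intro z hz
      obtain ⟨i, hi⟩ := i
      rcases i with _ | i
      · exact hm.inr_zero hz _ hi
      · refine (hm.inr_succ hz _ i hi).congr_deriv ?_
        rw [hm.inr_inr_of_lt hUs _ _ _ (by simp) z hz]; simp
    rw [eq_of_deriv_eq_zero hUs (g := fun z => m z (Sum.inr i) (Sum.inr i)) h0 z hz, hm.1]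
    simp [iterInt]
  | succ d ih =>
    obtain ⟨j, rfl⟩ : ∃ j', j = j' + 1 := ⟨i.val + d, by omega⟩
    rw [drop_take_succ _ _ (by omega) (by omega)]
    refine eq_of_hasDerivAt_eq hUs (fun z hz => hm.inr_succ hz _ j hj) (fun z hz => ?_) ?_
    · refine ((hasDerivAt_iterInt hU hUs hs _ _ hz).const_mul _).congr_deriv ?_
      rw [ih j (by omega) (by omega) z hz]
      ring
    · rw [hm.1, iterInt_base, mul_zero, Matrix.one_apply_ne]
      simp [Fin.ext_iff]; omega

theorem VectorTransport.eq_bigF_inl (hm : VectorTransport U z₀ s m) (hn : 3 ≤ n)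
    (hU : IsOpen U) (hUs : StarConvex ℝ z₀ U) (hs : ∀ j, DifferentiableOn ℂ (s j) U) (k : Fin n) :
    ∀ z ∈ U, m z (Sum.inl k) (Sum.inl ⟨0, by omega⟩) = bigF s z₀ (Sum.inl k) z := by
  have hk := k.isLt
  rcases Nat.lt_or_ge k.val (n - 1) with hk1 | hk1
  · refine hm.climb hUs _ k.val (by omega) (fun l => iterInt s z₀ l)
      (fun i l z hz => hasDerivAt_iterInt hU hUs hs i l hz) (fun i l => iterInt_base i l)
      (fun j hj hjk => ?_) fun z hz => ?_
    · simp [Fin.ext_iff]; omega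
    · rw [hm.inl_inl hUs (by omega) k (n - 1 - k.val) k.val (by omega) le_rfl z hz]
      simp [iterInt]
  · have hk2 : k.val = n - 1 := by omega
    obtain ⟨p, hp⟩ : ∃ p : Fin n, p = ⟨n - 2, by omega⟩ := ⟨_, rfl⟩
    obtain ⟨G, hG⟩ : ∃ G : List (Fin n) → ℂ → ℂ, ∀ l, G l = iterInt s z₀ (l ++ [p]) :=
      ⟨fun l => iterInt s z₀ (l ++ [p]), fun _ => rfl⟩
    have h1 : ∀ z ∈ U, m z (Sum.inl k) (Sum.inl ⟨n - 2, by omega⟩) = G [] z := by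
      rw [hG, List.nil_append]
      refine eq_of_hasDerivAt_eq hUs (fun z hz => hm.inl_penult hz _ (by omega))
        (fun z hz => ?_) ?_
      · refine (hasDerivAt_iterInt hU hUs hs _ _ hz).congr_deriv ?_
        rw [hm.inl_inr hUs k _ _ z hz,
          hm.inl_inl hUs (by omega) k 0 (n - 1) (by omega) (by omega) z hz, if_pos hk2, hp]
        simp [iterInt]
      · rw [iterInt_base, hm.1, Matrix.one_apply_ne]
        simp [Fin.ext_iff]; omega
    have h2 := hm.climb hUs (Sum.inl k) (n - 2) (by omega) G
      (fun i l z hz => by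
        rw [hG, hG, List.cons_append]; exact hasDerivAt_iterInt hU hUs hs i _ hz)
      (fun i l => by rw [hG, List.cons_append]; exact iterInt_base i _)
      (fun j hj hjk => by simp [Fin.ext_iff]; omega) h1
    have h3 : List.take (n - 2) (List.finRange n) ++ [p] = List.take k.val (List.finRange n) := by
      rw [hk2, hp, show n - 1 = n - 2 + 1 by omega, List.take_add_one]
      simp [show n - 2 < n by omega]
    intro z hz
    rw [h2 z hz, hG, h3, bigF]

theorem VectorTransport.eq_bigF_inr_last (hm : VectorTransport U z₀ s m) (hn : 3 ≤ n)
    (hU : IsOpen U) (hUs : StarConvex ℝ z₀ U) (hs : ∀ j, DifferentiableOn ℂ (s j) U)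
    (i : Fin n) (hi : i.val = n - 1) :
    ∀ z ∈ U, m z (Sum.inr i) (Sum.inl ⟨0, by omega⟩) = bigF s z₀ (Sum.inr i) z := by
  have h0 : ∀ z ∈ U, m z (Sum.inr i) (Sum.inl ⟨n - 1, by omega⟩) = 0 := by
    intro z hz
    rw [eq_of_deriv_eq_zero hUs (g := fun z => m z (Sum.inr i) (Sum.inl ⟨n - 1, by omega⟩))
      (fun z hz => (hm.inl_last hz _ (by omega)).congr_deriv ?_) z hz, hm.1,
      Matrix.one_apply_ne (by simp)]
    rw [hm.inr_inr_of_lt hUs _ _ _ (by omega) z hz]; simp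
  obtain ⟨q, hq⟩ : ∃ q : Fin n, q = ⟨n - 1, by omega⟩ := ⟨_, rfl⟩
  obtain ⟨G, hG⟩ : ∃ G : List (Fin n) → ℂ → ℂ, ∀ l, G l = iterInt s z₀ (l ++ [q]) :=
    ⟨fun l => iterInt s z₀ (l ++ [q]), fun _ => rfl⟩
  have h1 : ∀ z ∈ U, m z (Sum.inr i) (Sum.inl ⟨n - 2, by omega⟩) = G [] z := by
    rw [hG, List.nil_append]
    refine eq_of_hasDerivAt_eq hUs (fun z hz => hm.inl_penult hz _ (by omega))
      (fun z hz => ?_) ?_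
    · refine (hasDerivAt_iterInt hU hUs hs _ _ hz).congr_deriv ?_
      rw [h0 z hz, hm.inr_inr hU hUs hs i 0 (n - 1) (by omega) hi z hz,
        List.drop_eq_nil_of_le (by simp; omega), hq]
      simp [iterInt]
    · rw [iterInt_base, hm.1, Matrix.one_apply_ne (by simp)]
  have h2 := hm.climb hUs (Sum.inr i) (n - 2) (by omega) G
    (fun i l z hz => by
      rw [hG, hG, List.cons_append]; exact hasDerivAt_iterInt hU hUs hs i _ hz)
    (fun i l => by rw [hG, List.cons_append]; exact iterInt_base i _)
    (fun j hj hjk => by simp) h1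
  intro z hz
  rw [h2 z hz, hG, bigF]
  simp only [← hq]
  rw [if_pos (by rw [hq]; exact Fin.ext hi)]

theorem VectorTransport.eq_bigF_inr (hm : VectorTransport U z₀ s m) (hn : 3 ≤ n)
    (hU : IsOpen U) (hUs : StarConvex ℝ z₀ U) (hs : ∀ j, DifferentiableOn ℂ (s j) U)
    (i : Fin n) (hi : i.val < n - 1) :
    ∀ z ∈ U, m z (Sum.inr i) (Sum.inl ⟨0, by omega⟩) = bigF s z₀ (Sum.inr i) z := by
  have hD := fun i l z hz => hasDerivAt_iterInt (z := z) hU hUs hs i l hz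
  obtain ⟨tail, htail⟩ : ∃ t, t = (((List.finRange n).take (n - 2)).drop i.val).reverse := ⟨_, rfl⟩
  obtain ⟨c, hc⟩ : ∃ c : ℂ, c = (-1) ^ (n - 1 - i.val) := ⟨_, rfl⟩
  have hc' : c = -(-1) ^ (n - 2 - i.val) := by
    rw [hc, show n - 1 - i.val = n - 2 - i.val + 1 by omega]; ring
  obtain ⟨p, hp⟩ : ∃ p : Fin n, p = ⟨n - 2, by omega⟩ := ⟨_, rfl⟩
  obtain ⟨q, hq⟩ : ∃ q : Fin n, q = ⟨n - 1, by omega⟩ := ⟨_, rfl⟩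
  have ht : ∀ z ∈ U, m z (Sum.inr i) (Sum.inr p)
      = (-1) ^ (n - 2 - i.val) * iterInt s z₀ tail z := by
    rw [hp, htail]
    exact hm.inr_inr hU hUs hs i _ (n - 2) (by omega) (by omega)
  have h1 : ∀ z ∈ U, m z (Sum.inr i) (Sum.inr q) = c * iterInt s z₀ (p :: tail) z := by
    have h := hm.inr_inr hU hUs hs i (n - 1 - i.val) (n - 1) (by omega) (by omega)
    have h2 := drop_take_succ (n := n) i.val (n - 2) (by omega) (by omega)
    rw [show n - 2 + 1 = n - 1 by omega, ← htail, ← hp] at h2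
    rwa [h2, ← hq, ← hc] at h
  have h2 : ∀ z ∈ U, m z (Sum.inr i) (Sum.inl q) = c * iterInt s z₀ (q :: tail) z := by
    refine eq_of_hasDerivAt_eq hUs
      (fun z hz => by have := hm.inl_last hz (Sum.inr i) (by omega); rwa [← hq, ← hp] at this)
      (fun z hz => ?_) ?_
    · refine ((hD _ _ z hz).const_mul c).congr_deriv ?_
      rw [ht z hz, hc']; ring
    · rw [iterInt_base, hm.1, Matrix.one_apply_ne (by simp), mul_zero]
  obtain ⟨G, hG⟩ : ∃ G : List (Fin n) → ℂ → ℂ, G = fun l z =>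
      c * (iterInt s z₀ (l ++ p :: q :: tail) z + iterInt s z₀ (l ++ q :: p :: tail) z) := ⟨_, rfl⟩
  have h3 : ∀ z ∈ U, m z (Sum.inr i) (Sum.inl p) = G [] z := by
    subst hG
    refine eq_of_hasDerivAt_eq hUs
      (fun z hz => by have := hm.inl_penult hz (Sum.inr i) (by omega); rwa [← hq, ← hp] at this)
      (fun z hz => ?_) ?_
    · refine (((hD p (q :: tail) z hz).add (hD q (p :: tail) z hz)).const_mul c).congr_deriv ?_
      rw [h1 z hz, h2 z hz]; ring
    · simp only [List.nil_append]
      rw [iterInt_base, iterInt_base, hm.1, Matrix.one_apply_ne (by simp), add_zero, mul_zero]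
  rw [hp] at h3
  have h4 := hm.climb hUs (Sum.inr i) (n - 2) (by omega) G
    (fun j l z hz => by
      subst hG
      simp only [List.cons_append]
      refine (((hD j _ z hz).add (hD j _ z hz)).const_mul c).congr_deriv ?_
      ring)
    (fun j l => by subst hG; simp [iterInt_base]) (fun j hj hjk => by simp) h3
  intro z hz
  have hi' : ¬ i = q := by rw [hq]; simp only [Fin.ext_iff]; omega
  simp only [h4 z hz, hG, bigF, ← htail, ← hc, ← hp, ← hq, List.append_assoc,
    List.cons_append, List.nil_append]
  rw [if_neg hi']

/-- The functions `F^A` are the first column of the transport matrix. -/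
theorem VectorTransport.eq_bigF (hm : VectorTransport U z₀ s m) (hn : 3 ≤ n)
    (hU : IsOpen U) (hUs : StarConvex ℝ z₀ U) (hs : ∀ j, DifferentiableOn ℂ (s j) U) (A : Idx n) :
    ∀ z ∈ U, m z A (Sum.inl ⟨0, by omega⟩) = bigF s z₀ A z := by
  rcases A with k | i
  · exact hm.eq_bigF_inl hn hU hUs hs k
  · rcases Nat.lt_or_ge i.val (n - 1) with hi | hi
    · exact hm.eq_bigF_inr hn hU hUs hs i hi
    · exact hm.eq_bigF_inr_last hn hU hUs hs i (by have := i.isLt; omega)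

end Columns

/-! ### The Cartan matrix and the exponents -/

section Exponents

variable {n : ℕ}

/-- The label `j + 1 > 0`, for `j < n`. -/
def pos {n : ℕ} [NeZero n] (j : ℕ) : Idx n := Sum.inl (Fin.ofNat n j)

theorem pos_eq [NeZero n] {j : ℕ} (hj : j < n) : (pos j : Idx n) = Sum.inl ⟨j, hj⟩ := by
  simp [pos, Fin.ext_iff, Nat.mod_eq_of_lt hj]

/-- The last two components of a weight combined: `η_0 = 0`, `η_j = x_j` for `j ≤ n - 2` and
`η_{n-1} = x_{n-1} + x_n`, in terms of which all but the last two rows of the Cartan matrix are those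
of type `A`. -/
def eta (x : Fin n → ℂ) : ℕ → ℂ
  | 0 => 0
  | j + 1 =>
    if h : j + 2 < n then x ⟨j, by omega⟩
    else if h : j + 2 = n then x ⟨n - 2, by omega⟩ + x ⟨n - 1, by omega⟩ else 0

/-- The Cartan matrix of `D_n` with complex entries. -/
abbrev cartan (n : ℕ) : Matrix (Fin n) (Fin n) ℂ := (CartanMatrix.D n).map (Int.cast : ℤ → ℂ)

theorem sum_ite_val_eq (x : Fin n → ℂ) (k : ℕ) (hk : k < n) :
    ∑ j : Fin n, (if j.val = k then x j else 0) = x ⟨k, hk⟩ := by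
  rw [Finset.sum_eq_single ⟨k, hk⟩]
  · simp
  · intro j _ hj
    rw [if_neg (fun h => hj (Fin.ext h))]
  · simp

theorem cartan_mulVec (hn : 3 ≤ n) (x : Fin n → ℂ) (i : ℕ) (hi : i + 2 < n) :
    ((cartan n).mulVec x) ⟨i, by omega⟩ = 2 * eta x (i + 1) - eta x i - eta x (i + 2) := by
  have h : ∀ j : Fin n, cartan n ⟨i, by omega⟩ j * x j = 2 * (if j.val = i then x j else 0)
      - (if j.val + 1 = i then x j else 0) - (if j.val = i + 1 then x j else 0)
      - (if i + 3 = n then (if j.val = n - 1 then x j else 0) else 0) := by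
    intro j
    have := j.isLt
    simp only [Matrix.map_apply, CartanMatrix.D, Matrix.of_apply, Fin.ext_iff]
    split_ifs <;> first | omega | simp
  rw [Matrix.mulVec, dotProduct, Finset.sum_congr rfl fun j _ => h j]
  simp only [Finset.sum_sub_distrib, ← Finset.mul_sum]
  rw [sum_ite_val_eq x i (by omega), sum_ite_val_eq x (i + 1) (by omega)]
  have h1 : ∑ j : Fin n, (if j.val + 1 = i then x j else 0) = eta x i := by
    rcases i with _ | i
    · simp [eta]
    · simp only [Nat.add_right_cancel_iff]
      rw [sum_ite_val_eq x i (by omega), eta, dif_pos (by omega)]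
  have h2 : x ⟨i + 1, by omega⟩
      + ∑ j : Fin n, (if i + 3 = n then (if j.val = n - 1 then x j else 0) else 0)
      = eta x (i + 2) := by
    rw [eta]
    by_cases h3 : i + 3 = n
    · simp only [if_pos h3]
      rw [dif_neg (by omega), dif_pos (by omega), sum_ite_val_eq x (n - 1) (by omega)]
      simp only [← h3]; rfl
    · simp only [if_neg h3]
      rw [dif_pos (by omega)]
      simp
  rw [h1, ← h2, eta, dif_pos hi]
  ring

theorem eta_antepenult (hn : 3 ≤ n) (x : Fin n → ℂ) : eta x (n - 2) = x ⟨n - 3, by omega⟩ := by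
  obtain ⟨N, rfl⟩ : ∃ N, n = N + 3 := ⟨n - 3, by omega⟩
  exact dif_pos (by omega)

theorem cartan_mulVec_penult (hn : 3 ≤ n) (x : Fin n → ℂ) :
    ((cartan n).mulVec x) ⟨n - 2, by omega⟩ = 2 * x ⟨n - 2, by omega⟩ - eta x (n - 2) := by
  have h : ∀ j : Fin n, cartan n ⟨n - 2, by omega⟩ j * x j
      = 2 * (if j.val = n - 2 then x j else 0) - (if j.val = n - 3 then x j else 0) := by
    intro j
    have := j.isLt
    simp only [Matrix.map_apply, CartanMatrix.D, Matrix.of_apply, Fin.ext_iff]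
    split_ifs <;> first | omega | simp
  rw [Matrix.mulVec, dotProduct, Finset.sum_congr rfl fun j _ => h j]
  simp only [Finset.sum_sub_distrib, ← Finset.mul_sum]
  rw [sum_ite_val_eq x (n - 2) (by omega), sum_ite_val_eq x (n - 3) (by omega),
    ← eta_antepenult hn x]

theorem cartan_mulVec_last (hn : 3 ≤ n) (x : Fin n → ℂ) :
    ((cartan n).mulVec x) ⟨n - 1, by omega⟩ = 2 * x ⟨n - 1, by omega⟩ - eta x (n - 2) := by
  have h : ∀ j : Fin n, cartan n ⟨n - 1, by omega⟩ j * x j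
      = 2 * (if j.val = n - 1 then x j else 0) - (if j.val = n - 3 then x j else 0) := by
    intro j
    have := j.isLt
    simp only [Matrix.map_apply, CartanMatrix.D, Matrix.of_apply, Fin.ext_iff]
    split_ifs <;> first | omega | simp
  rw [Matrix.mulVec, dotProduct, Finset.sum_congr rfl fun j _ => h j]
  simp only [Finset.sum_sub_distrib, ← Finset.mul_sum]
  rw [sum_ite_val_eq x (n - 1) (by omega), sum_ite_val_eq x (n - 3) (by omega),
    ← eta_antepenult hn x]

theorem eta_penult (hn : 3 ≤ n) (x : Fin n → ℂ) :
    eta x (n - 1) = x ⟨n - 2, by omega⟩ + x ⟨n - 1, by omega⟩ := by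
  obtain ⟨N, rfl⟩ : ∃ N, n = N + 2 := ⟨n - 2, by omega⟩
  exact (dif_neg (by omega)).trans (dif_pos rfl)

/-- A null vector of the Cartan matrix grows linearly, which is incompatible with the last two
rows. -/
theorem cartan_det_ne_zero (hn : 3 ≤ n) : (cartan n).det ≠ 0 := by
  intro h0
  obtain ⟨x, hx, hKx⟩ := Matrix.exists_mulVec_eq_zero_iff.2 h0
  have hlin : ∀ j, j + 1 ≤ n → eta x j = j * eta x 1 := by
    intro j
    induction j using Nat.strong_induction_on with
    | _ j ih =>
      intro hj
      rcases j with _ | _ | j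
      · simp [eta]
      · simp
      · have h := cartan_mulVec hn x j (by omega)
        rw [hKx, Pi.zero_apply, ih j (by omega) (by omega), ih (j + 1) (by omega) (by omega)] at h
        push_cast at h ⊢
        linear_combination h
  have h1 := cartan_mulVec_penult hn x
  have h2 := cartan_mulVec_last hn x
  have h3 := eta_penult hn x
  rw [hKx, Pi.zero_apply] at h1 h2
  have h4 : eta x 1 = 0 := by
    have e1 := hlin (n - 1) (by omega)
    have e2 := hlin (n - 2) (by omega)
    rw [show n - 1 = n - 2 + 1 by omega] at e1
    push_cast at e1
    rw [show n - 2 + 1 = n - 1 by omega] at e1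
    linear_combination -e1 + e2 + h3 - h1 / 2 - h2 / 2
  refine hx (funext fun i => ?_)
  have hi := i.isLt
  have h5 : ∀ j, j + 1 ≤ n → eta x j = 0 := fun j hj => by rw [hlin j hj, h4, mul_zero]
  rw [h5 (n - 2) (by omega)] at h1 h2
  rcases (by omega : i.val + 2 < n ∨ i.val = n - 2 ∨ i.val = n - 1) with h | h | h
  · have := h5 (i.val + 1) (by omega)
    rwa [eta, dif_pos h] at this
  · rw [show i = ⟨n - 2, by omega⟩ from Fin.ext h, Pi.zero_apply]
    linear_combination -h1 / 2
  · rw [show i = ⟨n - 1, by omega⟩ from Fin.ext h, Pi.zero_apply]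
    linear_combination -h2 / 2

variable {U : Set ℂ} (S : Screening n U)

theorem cartan_mulVec_xi (hn : 3 ≤ n) (z : ℂ) :
    (cartan n).mulVec (fun k => xi S k z) = fun j => S.logS j z := by
  have : (fun k => xi S k z) = (cartan n)⁻¹.mulVec fun j => S.logS j z := rfl
  rw [this, Matrix.mulVec_mulVec, Matrix.mul_nonsing_inv _ (cartan_det_ne_zero hn).isUnit,
    Matrix.one_mulVec]

/-- The exponents `η_j` of the weight `ξ`; the coefficient of the column `m e_{j+1}` in `f^{(j)}` is
`exp (η_j - η_{j+1})`. -/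
def expo (z : ℂ) : ℕ → ℂ := eta fun k => xi S k z

theorem exp_expo_mul (hn : 3 ≤ n) {z : ℂ} (hz : z ∈ U) (i : ℕ) (hi : i + 2 < n) :
    Complex.exp (expo S z i - expo S z (i + 1)) * S.s ⟨i, by omega⟩ z
      = Complex.exp (expo S z (i + 1) - expo S z (i + 2)) := by
  rw [← S.exp_logS _ z hz, ← Complex.exp_add]
  have h := cartan_mulVec hn (fun k => xi S k z) i hi
  rw [cartan_mulVec_xi S hn] at h
  congr 1
  beta_reduce at h
  rw [h]
  simp only [expo]
  ring

theorem exp_expo_mul_penult (hn : 3 ≤ n) {z : ℂ} (hz : z ∈ U) :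
    Complex.exp (expo S z (n - 2) - expo S z (n - 1)) * S.s ⟨n - 2, by omega⟩ z
      = Complex.exp (xi S ⟨n - 2, by omega⟩ z - xi S ⟨n - 1, by omega⟩ z) := by
  rw [← S.exp_logS _ z hz, ← Complex.exp_add]
  have h := cartan_mulVec_penult hn (fun k => xi S k z)
  rw [cartan_mulVec_xi S hn] at h
  congr 1
  beta_reduce at h
  rw [h, expo, eta_penult hn]
  ring

theorem exp_expo_mul_last (hn : 3 ≤ n) {z : ℂ} (hz : z ∈ U) :
    Complex.exp (expo S z (n - 2) - expo S z (n - 1)) * S.s ⟨n - 1, by omega⟩ z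
      = Complex.exp (-(xi S ⟨n - 2, by omega⟩ z - xi S ⟨n - 1, by omega⟩ z)) := by
  rw [← S.exp_logS _ z hz, ← Complex.exp_add]
  have h := cartan_mulVec_last hn (fun k => xi S k z)
  rw [cartan_mulVec_xi S hn] at h
  congr 1
  beta_reduce at h
  rw [h, expo, eta_penult hn]
  ring

theorem differentiableOn_s (j : Fin n) : DifferentiableOn ℂ (S.s j) U :=
  ((S.logS_holo j).cexp).congr fun z hz => (S.exp_logS j z hz).symm

theorem differentiableOn_xi (k : Fin n) : DifferentiableOn ℂ (xi S k) U :=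
  DifferentiableOn.fun_sum fun j _ => (S.logS_holo j).const_mul _

theorem expo_zero (z : ℂ) : expo S z 0 = 0 := rfl

/-- The diagonal coefficients of the rows in the frame of the columns of `m`. -/
def rowCoeff (hn : 3 ≤ n) (a : ℕ) (z : ℂ) : ℂ :=
  if a + 1 = n then Complex.exp (xi S ⟨n - 2, by omega⟩ z - xi S ⟨n - 1, by omega⟩ z)
  else Complex.exp (expo S z a - expo S z (a + 1))

/-- The exponents telescope. -/
theorem prod_rowCoeff (hn : 3 ≤ n) (z : ℂ) (p : ℕ) (hp : p < n) :
    ∏ i ∈ Finset.range p, rowCoeff S hn i z = Complex.exp (-expo S z p) := by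
  induction p with
  | zero => simp [expo_zero]
  | succ p ih =>
    rw [Finset.prod_range_succ, ih (by omega), rowCoeff, if_neg (by omega), ← Complex.exp_add]
    congr 1
    ring

end Exponents

/-! ### Derivatives of the embedding functions -/

section Embedding

variable {n : ℕ} [NeZero n] {U : Set ℂ} {z₀ : ℂ} (S : Screening n U)
  {m : ℂ → Matrix (Idx n) (Idx n) ℂ}

theorem differentiableOn_emb (hU : IsOpen U) (hUs : StarConvex ℝ z₀ U) (A : Idx n) :
    DifferentiableOn ℂ (emb S z₀ A) U := by
  have h := differentiableOn_iterInt hU hUs (differentiableOn_s S)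
  refine (differentiableOn_xi S 0).neg.cexp.mul ?_
  rcases A with i | i
  · exact h _
  · simp only [bigF]
    split_ifs
    · exact h _
    · exact ((h _).add (h _)).const_mul _

theorem differentiableOn_iteratedDeriv (hU : IsOpen U) {f : ℂ → ℂ} (hf : DifferentiableOn ℂ f U)
    (j : ℕ) : DifferentiableOn ℂ (iteratedDeriv j f) U := by
  induction j with
  | zero => simpa using hf
  | succ j ih => rw [iteratedDeriv_succ]; exact ih.deriv hU

/-- The derivatives `f, …, f^{(n-2)}` are triangular combinations of the columns of `m`. -/
theorem iteratedDeriv_emb (hm : VectorTransport U z₀ S.s m) (hn : 3 ≤ n) (hU : IsOpen U)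
    (hUs : StarConvex ℝ z₀ U) (j : ℕ) (hj : j + 2 ≤ n) :
    ∃ r : ℕ → ℂ → ℂ, (∀ i, DifferentiableOn ℂ (r i) U) ∧
      (∀ z ∈ U, r j z = Complex.exp (expo S z j - expo S z (j + 1))) ∧
      ∀ A, ∀ z ∈ U, iteratedDeriv j (emb S z₀ A) z
        = ∑ i ∈ Finset.range (j + 1), r i z * m z A (pos i) := by
  induction j with
  | zero =>
    refine ⟨fun _ z => Complex.exp (-xi S 0 z), fun _ => (differentiableOn_xi S 0).neg.cexp,
      fun z hz => ?_, fun A z hz => ?_⟩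
    · rw [expo_zero, expo, eta, dif_pos (by omega), zero_sub]
      rfl
    · rw [iteratedDeriv_zero, emb, ← hm.eq_bigF hn hU hUs (differentiableOn_s S) A z hz]
      simp [pos_eq (show 0 < n by omega)]
  | succ j ih =>
    obtain ⟨r, hr, hrj, hf⟩ := ih (by omega)
    refine ⟨fun i z => (if i ≤ j then deriv (r i) z else 0)
      + if i = 0 then 0 else r (i - 1) z * S.s (Fin.ofNat n (i - 1)) z, fun i => ?_, fun z hz => ?_,
      fun A z hz => ?_⟩
    · refine DifferentiableOn.add ?_ ?_
      · split_ifs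
        · exact (hr i).deriv hU
        · exact differentiableOn_const _
      · split_ifs
        · exact differentiableOn_const _
        · exact (hr _).mul (differentiableOn_s S _)
    · beta_reduce
      rw [if_neg (by omega), if_neg (by omega), zero_add, Nat.add_sub_cancel, hrj z hz,
        ← exp_expo_mul S hn hz j (by omega)]
      congr 2
      exact Fin.ext (Nat.mod_eq_of_lt (by omega))
    · have hd : HasDerivAt (iteratedDeriv j (emb S z₀ A))
          (∑ i ∈ Finset.range (j + 1), (deriv (r i) z * m z A (pos i)
            + r i z * (S.s (Fin.ofNat n i) z * m z A (pos (i + 1))))) z := by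
        have h1 : HasDerivAt (fun z => ∑ i ∈ Finset.range (j + 1), r i z * m z A (pos i))
            (∑ i ∈ Finset.range (j + 1), (deriv (r i) z * m z A (pos i)
              + r i z * (S.s (Fin.ofNat n i) z * m z A (pos (i + 1))))) z := by
          refine HasDerivAt.fun_sum fun i hi => ?_
          have hi' := Finset.mem_range.1 hi
          have h2 := ((hr i).differentiableAt (hU.mem_nhds hz)).hasDerivAt
          have h3 := hm.inl hz A i (by omega)
          rw [← pos_eq, ← pos_eq] at h3
          have h4 : (Fin.ofNat n i) = ⟨i, by omega⟩ := Fin.ext (Nat.mod_eq_of_lt (by omega))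
          rw [h4]
          exact h2.mul h3
        exact h1.congr_of_eventuallyEq (Filter.eventually_of_mem (hU.mem_nhds hz) (hf A))
      rw [iteratedDeriv_succ, hd.deriv, Finset.sum_add_distrib]
      simp only [add_mul, Finset.sum_add_distrib]
      congr 1
      · rw [Finset.sum_range_succ _ (j + 1), if_neg (by omega), zero_mul, add_zero]
        refine Finset.sum_congr rfl fun i hi => ?_
        rw [if_pos (by have := Finset.mem_range.1 hi; omega)]
      · rw [Finset.sum_range_succ' _ (j + 1)]
        simp [mul_assoc]

/-- At the branching node the derivative `f^{(n-1)}` picks up both columns `m e_{±n}`, with coefficients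
inverse to each other. -/
theorem iteratedDeriv_emb_last (hm : VectorTransport U z₀ S.s m) (hn : 3 ≤ n) (hU : IsOpen U)
    (hUs : StarConvex ℝ z₀ U) {z : ℂ} (hz : z ∈ U) :
    ∃ r : ℕ → ℂ, ∀ A, iteratedDeriv (n - 1) (emb S z₀ A) z
        = ∑ i ∈ Finset.range (n - 1), r i * m z A (pos i)
        + Complex.exp (xi S ⟨n - 2, by omega⟩ z - xi S ⟨n - 1, by omega⟩ z) * m z A (pos (n - 1))
        + Complex.exp (-(xi S ⟨n - 2, by omega⟩ z - xi S ⟨n - 1, by omega⟩ z))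
          * m z A (Sum.inr ⟨n - 1, by omega⟩) := by
  obtain ⟨r, hr, hrj, hf⟩ := iteratedDeriv_emb S hm hn hU hUs (n - 2) (by omega)
  refine ⟨fun i => deriv (r i) z
      + if i = 0 then 0 else r (i - 1) z * S.s (Fin.ofNat n (i - 1)) z, fun A => ?_⟩
  have hd : HasDerivAt (iteratedDeriv (n - 2) (emb S z₀ A))
      (∑ i ∈ Finset.range (n - 2), (deriv (r i) z * m z A (pos i)
        + r i z * (S.s (Fin.ofNat n i) z * m z A (pos (i + 1))))
      + (deriv (r (n - 2)) z * m z A (pos (n - 2))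
        + r (n - 2) z * (S.s ⟨n - 2, by omega⟩ z * m z A (Sum.inl ⟨n - 1, by omega⟩)
          + S.s ⟨n - 1, by omega⟩ z * m z A (Sum.inr ⟨n - 1, by omega⟩)))) z := by
    have h1 : HasDerivAt (fun z => ∑ i ∈ Finset.range (n - 2), r i z * m z A (pos i)
        + r (n - 2) z * m z A (pos (n - 2)))
      (∑ i ∈ Finset.range (n - 2), (deriv (r i) z * m z A (pos i)
        + r i z * (S.s (Fin.ofNat n i) z * m z A (pos (i + 1))))
      + (deriv (r (n - 2)) z * m z A (pos (n - 2))
        + r (n - 2) z * (S.s ⟨n - 2, by omega⟩ z * m z A (Sum.inl ⟨n - 1, by omega⟩)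
          + S.s ⟨n - 1, by omega⟩ z * m z A (Sum.inr ⟨n - 1, by omega⟩)))) z := by
      refine HasDerivAt.add (HasDerivAt.fun_sum fun i hi => ?_) ?_
      · have hi' := Finset.mem_range.1 hi
        have h2 := ((hr i).differentiableAt (hU.mem_nhds hz)).hasDerivAt
        have h3 := hm.inl hz A i (by omega)
        rw [← pos_eq, ← pos_eq] at h3
        have h4 : (Fin.ofNat n i) = ⟨i, by omega⟩ := Fin.ext (Nat.mod_eq_of_lt (by omega))
        rw [h4]
        exact h2.mul h3
      · rw [pos_eq (show n - 2 < n by omega)]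
        exact ((hr (n - 2)).differentiableAt (hU.mem_nhds hz)).hasDerivAt.mul
          (hm.inl_penult hz A (by omega))
    refine h1.congr_of_eventuallyEq (Filter.eventually_of_mem (hU.mem_nhds hz) fun z hz => ?_)
    rw [hf A z hz, Finset.sum_range_succ]
  have hrn := hrj z hz
  rw [show n - 2 + 1 = n - 1 by omega] at hrn
  rw [← exp_expo_mul_penult S hn hz, ← exp_expo_mul_last S hn hz, ← hrn, pos_eq (show n - 1 < n by omega)]
  conv_lhs => rw [show n - 1 = n - 2 + 1 by omega]
  rw [iteratedDeriv_succ, hd.deriv, Finset.sum_add_distrib]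
  simp only [add_mul, Finset.sum_add_distrib]
  have e1 : ∑ i ∈ Finset.range (n - 1), deriv (r i) z * m z A (pos i)
      = ∑ i ∈ Finset.range (n - 2), deriv (r i) z * m z A (pos i)
        + deriv (r (n - 2)) z * m z A (pos (n - 2)) := by
    rw [show n - 1 = n - 2 + 1 by omega, Finset.sum_range_succ]
  have e2 : ∑ i ∈ Finset.range (n - 1),
      (if i = 0 then 0 else r (i - 1) z * S.s (Fin.ofNat n (i - 1)) z) * m z A (pos i)
      = ∑ i ∈ Finset.range (n - 2), r i z * (S.s (Fin.ofNat n i) z * m z A (pos (i + 1))) := by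
    rw [show n - 1 = n - 2 + 1 by omega, Finset.sum_range_succ']
    simp [mul_assoc]
  rw [e1, e2]
  ring

end Embedding

/-! ### Triangular changes of frame -/

section Triangular

variable {H : Type} [AddCommGroup H] [Module ℂ H]

theorem ket_of_eq_succ (x : ℕ → Module.End ℂ H) (v : H) {p q : ℕ} (h : q = p + 1) :
    ket (fun i : Fin q => x i) v = x p (ket (fun i : Fin p => x i) v) := by
  subst h
  rw [ket_succ]
  rfl

/-- A product of anticommuting operators only sees the diagonal of a triangular change of frame. -/
theorem ket_triangular (x y : ℕ → Module.End ℂ H) (c : ℕ → ℂ) (v : H) (p : ℕ)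
    (h : ∀ i < p, ∃ r : ℕ → ℂ, x i = c i • y i + ∑ j ∈ Finset.range i, r j • y j)
    (hy : ∀ i < p, ∀ j < p, y i * y j + y j * y i = 0) :
    ket (fun i : Fin p => x i) v = (∏ i ∈ Finset.range p, c i) • ket (fun i : Fin p => y i) v := by
  induction p with
  | zero => simp
  | succ p ih =>
    obtain ⟨r, hr⟩ := h p (by omega)
    have ih' := ih (fun i hi => h i (by omega)) fun i hi j hj => hy i (by omega) j (by omega)
    have h0 : ∀ j ∈ Finset.range p, r j • y j (ket (fun i : Fin p => y i) v) = 0 := fun j hj => by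
      have hj := Finset.mem_range.1 hj
      rw [mem_ket (fun i : Fin p => y i) v (fun i j => hy i (by omega) j (by omega)) ⟨j, hj⟩,
        smul_zero]
    rw [ket_succ, ket_succ]
    simp only [Fin.val_last, Fin.val_castSucc]
    rw [ih', hr, map_smul, LinearMap.add_apply, LinearMap.smul_apply, LinearMap.sum_apply]
    simp only [LinearMap.smul_apply]
    rw [Finset.sum_eq_zero h0, add_zero, smul_smul, Finset.prod_range_succ]

end Triangular

/-! ### The invariant bilinear form -/

section Form

variable {n : ℕ}

/-- The invariant form `∑_A u^A v^{-A}` of the vector representation. -/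
def form (u v : Idx n → ℂ) : ℂ := ∑ A, u A * v A.swap

theorem sum_swap (f : Idx n → ℂ) : ∑ A : Idx n, f A.swap = ∑ A, f A :=
  Equiv.sum_comp (Equiv.sumComm (Fin n) (Fin n)) f

theorem form_comm (u v : Idx n → ℂ) : form u v = form v u := by
  unfold form
  rw [← sum_swap]
  simp [mul_comm]

theorem form_add_right (u v w : Idx n → ℂ) : form u (v + w) = form u v + form u w := by
  simp [form, mul_add, Finset.sum_add_distrib]

theorem form_smul_right (a : ℂ) (u v : Idx n → ℂ) : form u (a • v) = a * form u v := by
  simp only [form, Pi.smul_apply, smul_eq_mul, Finset.mul_sum]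
  exact Finset.sum_congr rfl fun _ _ => by ring

theorem form_sum_right {ι : Type*} (s : Finset ι) (u : Idx n → ℂ) (v : ι → Idx n → ℂ) :
    form u (∑ i ∈ s, v i) = ∑ i ∈ s, form u (v i) := by
  simp only [form, Finset.sum_apply, Finset.mul_sum]
  exact Finset.sum_comm

theorem form_sub_left (u v w : Idx n → ℂ) : form (u - v) w = form u w - form v w := by
  simp [form, sub_mul, Finset.sum_sub_distrib]

theorem form_sub_right (u v w : Idx n → ℂ) : form u (v - w) = form u v - form u w := by
  simp [form, mul_sub, Finset.sum_sub_distrib]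

section

variable {H : Type} [AddCommGroup H] [Module ℂ H]

theorem field_add (a : Idx n → Module.End ℂ H) (u v : Idx n → ℂ) :
    field a (u + v) = field a u + field a v := by
  simp [field, add_smul, Finset.sum_add_distrib]

theorem field_smul (a : Idx n → Module.End ℂ H) (r : ℂ) (u : Idx n → ℂ) :
    field a (r • u) = r • field a u := by
  simp [field, mul_smul, Finset.smul_sum]

theorem field_sum (a : Idx n → Module.End ℂ H) {ι : Type*} (s : Finset ι) (u : ι → Idx n → ℂ) :
    field a (∑ i ∈ s, u i) = ∑ i ∈ s, field a (u i) := by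
  simp only [field, Finset.sum_apply, Finset.sum_smul]
  exact Finset.sum_comm

theorem field_anticomm (a : Idx n → Module.End ℂ H) (g : Idx n → Idx n → ℂ)
    (h : ∀ A B, a A * a B + a B * a A = g A B • 1) (u v : Idx n → ℂ) :
    field a u * field a v + field a v * field a u = (∑ A, ∑ B, u A * v B * g A B) • 1 := by
  unfold field
  rw [Finset.sum_mul_sum, Finset.sum_mul_sum, Finset.sum_comm (f := fun i j => v i • a i * u j • a j),
    ← Finset.sum_add_distrib, Finset.sum_smul]
  refine Finset.sum_congr rfl fun A _ => ?_
  rw [← Finset.sum_add_distrib, Finset.sum_smul]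
  refine Finset.sum_congr rfl fun B _ => ?_
  rw [smul_mul_smul_comm, smul_mul_smul_comm, mul_comm (v B), ← smul_add, h, smul_smul]

variable (R : FockRep n H)

theorem field_cr_anticomm (u v : Idx n → ℂ) :
    field R.cr u * field R.cr v + field R.cr v * field R.cr u = 0 := by
  rw [field_anticomm R.cr (fun _ _ => 0) (fun A B => by rw [R.cr_cr, zero_smul])]
  simp

theorem field_c_anticomm (u v : Idx n → ℂ) :
    field R.c u * field R.c v + field R.c v * field R.c u = form u v • 1 := by
  rw [field_anticomm R.c (fun A B => if A = B.swap then 1 else 0)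
    (fun A B => by rw [R.c_c]; split_ifs <;> simp)]
  congr 1
  unfold form
  refine Finset.sum_congr rfl fun A _ => ?_
  rw [Finset.sum_eq_single A.swap]
  · simp
  · intro B _ hB
    rw [if_neg (fun h => hB (by rw [h, Sum.swap_swap])), mul_zero]
  · simp

end

variable {U : Set ℂ} {z₀ : ℂ} {s : Fin n → ℂ → ℂ} {m : ℂ → Matrix (Idx n) (Idx n) ℂ}
  {H : Type} [AddCommGroup H] [Module ℂ H] {M : ℂ → Module.End ℂ H}

/-- The transport matrix is orthogonal, since the oscillators keep their anticommutators when they are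
transported. -/
theorem form_columns [FiniteDimensional ℂ H] (R : FockRep n H) (hM : Transport U z₀ s R.lowH M)
    (hUs : StarConvex ℝ z₀ U) (hs : ∀ j, ContinuousOn (s j) U) (hm : VectorTransport U z₀ s m)
    {z : ℂ} (hz : z ∈ U) (A B : Idx n) :
    form (fun C => m z C A) (fun C => m z C B) = if A = B.swap then 1 else 0 := by
  have hv : M z R.hvac = R.hvac := hM.apply_eq_self hUs R.lowH_hvac hz
  have h1 : ∀ A ψ, M z (R.c A ψ) = field R.c (fun C => m z C A) (M z ψ) := fun A ψ => by
    rw [hM.intertwine hUs hs R.lowH_comm hm hz]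
    simp [field, LinearMap.sum_apply]
  have h2 : M z ((R.c A * R.c B + R.c B * R.c A) R.hvac)
      = form (fun C => m z C A) (fun C => m z C B) • R.hvac := by
    rw [LinearMap.add_apply, Module.End.mul_apply, Module.End.mul_apply, map_add, h1, h1, h1, h1, hv,
      ← Module.End.mul_apply, ← Module.End.mul_apply, ← LinearMap.add_apply, field_c_anticomm]
    rfl
  rw [R.c_c] at h2
  have h3 : M z ((if A = B.swap then 1 else 0 : Module.End ℂ H) R.hvac)
      = (if A = B.swap then (1 : ℂ) else 0) • R.hvac := by
    split_ifs <;> simp [hv]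
  rw [h3] at h2
  exact (smul_left_injective ℂ R.hvac_ne_zero h2).symm

/-- The columns of an orthogonal matrix form a basis, with the dual basis for the form given by the
opposite columns. -/
theorem expand_columns (C : Matrix (Idx n) (Idx n) ℂ)
    (h : ∀ A B, form (fun D => C D A) (fun D => C D B) = if A = B.swap then 1 else 0)
    (g : Idx n → ℂ) :
    g = ∑ B, form g (fun D => C D B.swap) • fun D => C D B := by
  let Ci : Matrix (Idx n) (Idx n) ℂ := Matrix.of fun B D => C D.swap B.swap
  have h1 : Ci * C = 1 := by
    ext B A
    rw [Matrix.mul_apply, Matrix.one_apply]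
    have := h B.swap A
    rw [form, ← sum_swap] at this
    simp only [Sum.swap_swap] at this
    simp only [Ci, Matrix.of_apply]
    rw [this]
    refine if_congr ⟨fun h => ?_, fun h => by rw [h]⟩ rfl rfl
    rw [← B.swap_swap, h, Sum.swap_swap]
  have h2 : C * Ci = 1 := mul_eq_one_comm.1 h1
  have h3 : C.mulVec (Ci.mulVec g) = g := by rw [Matrix.mulVec_mulVec, h2, Matrix.one_mulVec]
  funext D
  conv_lhs => rw [← h3]
  simp only [Finset.sum_apply, Pi.smul_apply, smul_eq_mul, Matrix.mulVec, dotProduct]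
  refine Finset.sum_congr rfl fun B _ => ?_
  rw [mul_comm]
  congr 1
  unfold form
  refine Finset.sum_congr rfl fun A _ => ?_
  simp only [Ci, Matrix.of_apply]
  rw [mul_comm]

end Form

/-! ### The rows of the surfaces -/

section Rows

variable {n : ℕ} [NeZero n] {U : Set ℂ} {z₀ : ℂ} (S : Screening n U)
  {m : ℂ → Matrix (Idx n) (Idx n) ℂ}

/-- The vector `f^{(a)}`. -/
def embD (z₀ : ℂ) (a : ℕ) (z : ℂ) : Idx n → ℂ := fun A => iteratedDeriv a (emb S z₀ A) z

/-- The row `X^{a+1}` of the surfaces. -/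
def row (z₀ : ℂ) (a : ℕ) (z : ℂ) : Idx n → ℂ :=
  fun A => iteratedDeriv a (emb S z₀ A) z - if a + 1 = n then fPar S z₀ A z else 0

/-- The column of `m` with label `a + 1`. -/
def col (m : ℂ → Matrix (Idx n) (Idx n) ℂ) (a : ℕ) (z : ℂ) : Idx n → ℂ := fun A => m z A (pos a)

theorem row_of_lt {a : ℕ} (ha : a + 1 < n) (z : ℂ) : row S z₀ a z = embD S z₀ a z := by
  funext A
  simp [row, embD, ha.ne]

theorem embD_triangular (hm : VectorTransport U z₀ S.s m) (hn : 3 ≤ n) (hU : IsOpen U)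
    (hUs : StarConvex ℝ z₀ U) {z : ℂ} (hz : z ∈ U) (a : ℕ) (ha : a + 1 < n) :
    ∃ r : ℕ → ℂ, embD S z₀ a z
      = rowCoeff S hn a z • col m a z + ∑ j ∈ Finset.range a, r j • col m j z := by
  obtain ⟨r, -, hr, hf⟩ := iteratedDeriv_emb S hm hn hU hUs a (by omega)
  refine ⟨fun j => r j z, funext fun A => ?_⟩
  rw [embD, hf A z hz, Finset.sum_range_succ, hr z hz, rowCoeff, if_neg ha.ne, add_comm]
  simp [col, Finset.sum_apply]

theorem form_fPar_fPar (z : ℂ) :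
    form (fun A => fPar S z₀ A z) (fun A => fPar S z₀ A z) = 0 := by
  simp [form, fPar]

/-- The defining property of `f_∥`: it pairs to `δ_{p,n-1}` with `f^{(p)}`. -/
theorem form_fPar_embD {z : ℂ} (hdet : (Theta S z₀ z).det ≠ 0) (p : Fin n) :
    form (fun A => fPar S z₀ A z) (embD S z₀ p z) = if p = lastIdx n then 1 else 0 := by
  have h : ∀ q, (Theta S z₀ z) p q = ∑ i, embD S z₀ p z (Sum.inl i) * embD S z₀ q z (Sum.inr i) :=
    fun q => rfl
  have h1 : form (fun A => fPar S z₀ A z) (embD S z₀ p z)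
      = ((Theta S z₀ z) * (Theta S z₀ z)⁻¹) p (lastIdx n) := by
    rw [Matrix.mul_apply]
    simp only [form, Fintype.sum_sum_type, Sum.swap_inl, Sum.swap_inr, fPar, zero_mul,
      Finset.sum_const_zero, zero_add, h, Finset.sum_mul]
    rw [Finset.sum_comm]
    refine Finset.sum_congr rfl fun q _ => Finset.sum_congr rfl fun i _ => ?_
    simp only [embD]
    ring
  rw [h1, Matrix.mul_nonsing_inv _ hdet.isUnit, Matrix.one_apply]

variable {H : Type} [AddCommGroup H] [Module ℂ H] {M : ℂ → Module.End ℂ H}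

/-- The positive parts of the rows are linearly independent where `Θ` is invertible, so that the rows
build a nonzero state on the half-spin vacuum. -/
theorem ket_rows_ne_zero (R : FockRep n H) {z : ℂ} (hdet : (Theta S z₀ z).det ≠ 0) :
    ket (fun i : Fin n => field R.c (row S z₀ i z)) R.hvac ≠ 0 := by
  let P : Matrix (Fin n) (Fin n) ℂ := Matrix.of fun p i => embD S z₀ p z (Sum.inl i)
  let Q : Matrix (Fin n) (Fin n) ℂ := Matrix.of fun p i => embD S z₀ p z (Sum.inr i)
  have hPQ : Theta S z₀ z = P * Q.transpose := by
    ext p q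
    rw [Matrix.mul_apply]
    rfl
  have hP : IsUnit P.det := by
    rw [hPQ, Matrix.det_mul] at hdet
    exact (left_ne_zero_of_mul hdet).isUnit
  let w : Fin n → Idx n → ℂ := fun i => Sum.elim (fun _ => 0) fun l => P⁻¹ l i
  refine ket_ne_zero _ (fun i => field R.c (w i)) _ R.hvac_ne_zero (fun i j => ?_) fun i => ?_
  · rw [field_c_anticomm]
    have : form (w i) (row S z₀ j z) = (P * P⁻¹) j i := by
      rw [Matrix.mul_apply]
      simp [form, w, Fintype.sum_sum_type, row, fPar, P, embD, mul_comm]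
    rw [this, Matrix.mul_nonsing_inv _ hP, Matrix.one_apply]
    simp only [eq_comm (a := j)]
    split_ifs <;> simp
  · simp [field, LinearMap.sum_apply, Fintype.sum_sum_type, w, R.c_inr_hvac]

theorem form_col_col [FiniteDimensional ℂ H] (R : FockRep n H) (hM : Transport U z₀ S.s R.lowH M)
    (hUs : StarConvex ℝ z₀ U) (hm : VectorTransport U z₀ S.s m) {z : ℂ} (hz : z ∈ U) (i j : ℕ) :
    form (col m i z) (col m j z) = 0 := by
  unfold col
  rw [form_columns R hM hUs (fun j => (differentiableOn_s S j).continuousOn) hm hz, if_neg]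
  simp [pos]

/-- The last row: `f^{(n-1)} - f_∥` is the isotropic vector of `m e_n`, and not of `m e_{-n}`, because
the other choice would build the zero state, contrary to `ket_rows_ne_zero`. -/
theorem row_last [FiniteDimensional ℂ H] (R : FockRep n H) (hM : Transport U z₀ S.s R.lowH M)
    (hm : VectorTransport U z₀ S.s m) (hn : 3 ≤ n) (hU : IsOpen U) (hUs : StarConvex ℝ z₀ U) {z : ℂ}
    (hz : z ∈ U) (hdet : (Theta S z₀ z).det ≠ 0) :
    ∃ r : ℕ → ℂ, row S z₀ (n - 1) z
      = rowCoeff S hn (n - 1) z • col m (n - 1) z + ∑ j ∈ Finset.range (n - 1), r j • col m j z := by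
  have hs : ∀ j, ContinuousOn (S.s j) U := fun j => (differentiableOn_s S j).continuousOn
  have hJ := form_columns R hM hUs hs hm hz
  obtain ⟨g, hg⟩ : ∃ g, g = row S z₀ (n - 1) z := ⟨_, rfl⟩
  obtain ⟨e, he⟩ : ∃ e : Idx n → Idx n → ℂ, e = fun B D => m z D B := ⟨_, rfl⟩
  have hcol : ∀ i, col m i z = e (pos i) := fun i => by rw [he]; rfl
  have heJ : ∀ A B, form (e A) (e B) = if A = B.swap then 1 else 0 := fun A B => by
    rw [he]; exact hJ A B
  obtain ⟨t, ht⟩ : ∃ t, t = fun A => fPar S z₀ A z := ⟨_, rfl⟩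
  have hgt : g = embD S z₀ (n - 1) z - t := by
    rw [hg, ht]
    funext A
    simp [row, embD, show n - 1 + 1 = n by omega]
  have hlast : lastIdx n = ⟨n - 1, by omega⟩ := rfl
  -- the derivative of order `n - 1`
  obtain ⟨κ, hκ⟩ : ∃ κ, κ = rowCoeff S hn (n - 1) z := ⟨_, rfl⟩
  have hκ' : κ = Complex.exp (xi S ⟨n - 2, by omega⟩ z - xi S ⟨n - 1, by omega⟩ z) := by
    rw [hκ, rowCoeff, if_pos (by omega)]
  have hκ0 : κ ≠ 0 := by rw [hκ']; exact Complex.exp_ne_zero _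
  obtain ⟨r, hr⟩ := iteratedDeriv_emb_last S hm hn hU hUs hz
  have hf : embD S z₀ (n - 1) z = ∑ i ∈ Finset.range (n - 1), r i • e (pos i)
      + κ • e (pos (n - 1)) + κ⁻¹ • e (Sum.inr ⟨n - 1, by omega⟩) := by
    funext A
    rw [embD, hr A, hκ', ← Complex.exp_neg, he]
    simp [Finset.sum_apply]
  have hpn : (pos (n - 1) : Idx n) = Sum.inl ⟨n - 1, by omega⟩ := pos_eq (by omega)
  have hpos : ∀ i j, form (e (pos i)) (e (pos j)) = 0 := fun i j => by
    rw [heJ, if_neg (by simp [pos])]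
  have hneg : ∀ j, j < n - 1 → form (e (Sum.inr ⟨n - 1, by omega⟩)) (e (pos j)) = 0 := fun j hj => by
    rw [heJ, pos_eq (show j < n by omega), if_neg]
    simp [Fin.ext_iff]; omega
  -- pairing of `g` with the columns `m e_j`, `j < n`
  have hfj : ∀ j, j < n - 1 → form (embD S z₀ (n - 1) z) (e (pos j)) = 0 := fun j hj => by
    rw [form_comm, hf, form_add_right, form_add_right, form_sum_right, form_smul_right,
      form_smul_right, hpos, form_comm _ (e (Sum.inr _)), hneg j hj]
    rw [Finset.sum_eq_zero fun i _ => by rw [form_smul_right, hpos, mul_zero]]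
    simp
  have htj : ∀ j, j < n - 1 → form t (e (pos j)) = 0 := by
    intro j
    induction j using Nat.strong_induction_on with
    | _ j ih =>
      intro hj
      obtain ⟨ρ, hρ⟩ := embD_triangular S hm hn hU hUs hz j (by omega)
      have h1 := form_fPar_embD S hdet ⟨j, by omega⟩
      rw [if_neg (by rw [hlast]; simp only [Fin.ext_iff]; omega), ← ht] at h1
      simp only [hρ] at h1
      rw [form_add_right, form_smul_right, form_sum_right, Finset.sum_eq_zero, add_zero] at h1
      · rw [hcol] at h1
        refine (mul_eq_zero.1 h1).resolve_left ?_
        rw [rowCoeff, if_neg (by omega)]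
        exact Complex.exp_ne_zero _
      · intro i hi
        have hi := Finset.mem_range.1 hi
        rw [form_smul_right, hcol, ih i hi (by omega), mul_zero]
  have hgj : ∀ j, j < n - 1 → form g (e (pos j)) = 0 := fun j hj => by
    rw [hgt, form_sub_left, hfj j hj, htj j hj, sub_zero]
  -- `α` and `β` are the components of `g` along `m e_n` and `m e_{-n}`
  obtain ⟨α, hα⟩ : ∃ α, α = form g (e (Sum.inr ⟨n - 1, by omega⟩)) := ⟨_, rfl⟩
  obtain ⟨β, hβ⟩ : ∃ β, β = form g (e (pos (n - 1))) := ⟨_, rfl⟩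
  have hpair : form g (embD S z₀ (n - 1) z) = κ * β + κ⁻¹ * α := by
    rw [hf, form_add_right, form_add_right, form_sum_right, form_smul_right, form_smul_right, ← hα,
      ← hβ, Finset.sum_eq_zero, zero_add]
    intro i hi
    rw [form_smul_right, hgj i (Finset.mem_range.1 hi), mul_zero]
  -- the components of `f^{(n-1)}` along `m e_{±n}` are inverse to each other
  have hff : form (embD S z₀ (n - 1) z) (embD S z₀ (n - 1) z) = 2 := by
    have h1 : form (embD S z₀ (n - 1) z) (e (pos (n - 1))) = κ⁻¹ := by
      rw [form_comm, hf, form_add_right, form_add_right, form_sum_right, form_smul_right,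
        form_smul_right, hpos, heJ, hpn, if_pos (by simp)]
      rw [Finset.sum_eq_zero fun i _ => by rw [← hpn, form_smul_right, hpos, mul_zero]]
      simp
    have h2 : form (embD S z₀ (n - 1) z) (e (Sum.inr ⟨n - 1, by omega⟩)) = κ := by
      rw [form_comm, hf, form_add_right, form_add_right, form_sum_right, form_smul_right,
        form_smul_right, heJ, heJ, hpn, if_pos (by simp), if_neg (by simp)]
      rw [Finset.sum_eq_zero fun i hi => by
        rw [form_smul_right, hneg i (Finset.mem_range.1 hi), mul_zero]]
      simp
    nth_rewrite 2 [hf]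
    rw [form_add_right, form_add_right, form_sum_right, form_smul_right, form_smul_right, h1, h2,
      Finset.sum_eq_zero fun i hi => by
        rw [form_smul_right, hfj i (Finset.mem_range.1 hi), mul_zero]]
    field_simp
    norm_num
  have htf : form t (embD S z₀ (n - 1) z) = 1 := by
    have := form_fPar_embD S hdet ⟨n - 1, by omega⟩
    rwa [if_pos hlast.symm, ← ht] at this
  -- the components of the isotropic vector `g`: `κ β + κ⁻¹ α = 1` and `α β = 0`
  have hone : κ * β + κ⁻¹ * α = 1 := by
    rw [← hpair, hgt, form_sub_left, hff, htf]; norm_num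
  have hgg : form g g = 0 := by
    have htt : form t t = 0 := by rw [ht]; exact form_fPar_fPar S z
    rw [hgt, form_sub_left, form_sub_right, form_sub_right, hff, htf, form_comm _ t, htf, htt]
    norm_num
  have hexp : g = ∑ i ∈ Finset.range (n - 1), form g (e (Sum.inr (Fin.ofNat n i))) • e (pos i)
      + α • e (pos (n - 1)) + β • e (Sum.inr ⟨n - 1, by omega⟩) := by
    have h1 := expand_columns (m z) hJ g
    have h2 : ∀ B, (fun D => m z D B) = e B := fun B => by rw [he]
    simp only [h2] at h1
    rw [Fintype.sum_sum_type] at h1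
    simp only [Sum.swap_inl, Sum.swap_inr] at h1
    have h3 : ∑ i : Fin n, form g (e (Sum.inl i)) • e (Sum.inr i)
        = β • e (Sum.inr ⟨n - 1, by omega⟩) := by
      rw [Finset.sum_eq_single ⟨n - 1, by omega⟩]
      · rw [hβ, hpn]
      · intro i _ hi
        have hi' : i.val < n - 1 := by
          have := i.isLt
          simp only [ne_eq, Fin.ext_iff] at hi
          omega
        have := hgj i hi'
        rw [pos_eq i.isLt] at this
        rw [this, zero_smul]
      · simp
    have h4 : ∑ i : Fin n, form g (e (Sum.inr i)) • e (Sum.inl i)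
        = ∑ i ∈ Finset.range (n - 1), form g (e (Sum.inr (Fin.ofNat n i))) • e (pos i)
          + α • e (pos (n - 1)) := by
      have h5 : ∀ i : Fin n, form g (e (Sum.inr i)) • e (Sum.inl i)
          = form g (e (Sum.inr (Fin.ofNat n i))) • e (pos i) := fun i => by
        rw [pos_eq i.isLt, show Fin.ofNat n i = i from Fin.ext (Nat.mod_eq_of_lt i.isLt)]
      rw [Finset.sum_congr rfl fun i _ => h5 i, Fin.sum_univ_eq_sum_range
        (fun i => form g (e (Sum.inr (Fin.ofNat n i))) • e (pos i)) n]
      have h6 : ∀ F : ℕ → Idx n → ℂ, ∑ i ∈ Finset.range n, F i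
          = ∑ i ∈ Finset.range (n - 1), F i + F (n - 1) := fun F => by
        rw [← Finset.sum_range_succ, Nat.sub_add_cancel (by omega)]
      rw [h6, hα, show Fin.ofNat n (n - 1) = ⟨n - 1, by omega⟩ from
        Fin.ext (Nat.mod_eq_of_lt (by omega))]
    rw [h3, h4] at h1
    exact h1
  have hαβ : α * β = 0 := by
    have h1 := hgg
    nth_rewrite 2 [hexp] at h1
    rw [form_add_right, form_add_right, form_sum_right, form_smul_right, form_smul_right, ← hα, ← hβ,
      Finset.sum_eq_zero fun i hi => by
        rw [form_smul_right, hgj i (Finset.mem_range.1 hi), mul_zero]] at h1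
    linear_combination h1 / 2
  -- `α = 0` would give the zero state
  have hα0 : α ≠ 0 := by
    intro h0
    rw [h0, zero_smul, add_zero] at hexp
    refine ket_rows_ne_zero S R hdet ?_
    have hK : ket (fun i : Fin (n - 1) => field R.c (row S z₀ i z)) R.hvac
        = (∏ i ∈ Finset.range (n - 1), rowCoeff S hn i z)
          • M z (ket (fun i : Fin (n - 1) => R.c (pos i)) R.hvac) := by
      rw [hM.apply_ket hUs hs R.lowH_comm hm hz R.lowH_hvac (fun i : Fin (n - 1) => pos i)]
      refine ket_triangular (fun i => field R.c (row S z₀ i z)) (fun i => field R.c (col m i z)) _ _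
        (n - 1) (fun i hi => ?_) fun i _ j _ => ?_
      · obtain ⟨ρ, hρ⟩ := embD_triangular S hm hn hU hUs hz i (by omega)
        refine ⟨ρ, ?_⟩
        rw [row_of_lt S (by omega), hρ, field_add, field_smul, field_sum]
        simp only [field_smul]
      · rw [field_c_anticomm, hcol, hcol, hpos, zero_smul]
    have hMc : ∀ B ψ, field R.c (e B) (M z ψ) = M z (R.c B ψ) := fun B ψ => by
      rw [hM.intertwine hUs hs R.lowH_comm hm hz, he]
      simp [field, LinearMap.sum_apply]
    have hk1 : ∀ i, i < n - 1 → R.c (pos i) (ket (fun i : Fin (n - 1) => R.c (pos i)) R.hvac) = 0 :=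
      fun i hi => mem_ket (fun i : Fin (n - 1) => R.c (pos i)) _
        (fun i j => by rw [R.c_c, if_neg (by simp [pos])]) ⟨i, hi⟩
    have hk2 : R.c (Sum.inr ⟨n - 1, by omega⟩)
        (ket (fun i : Fin (n - 1) => R.c (pos i)) R.hvac) = 0 := by
      refine anticomm_ket _ _ _ (fun i => ?_) (R.c_inr_hvac _)
      rw [R.c_c, if_neg]
      rw [pos_eq (by have := i.isLt; omega)]
      simp [Fin.ext_iff]; omega
    rw [ket_of_eq_succ (fun i => field R.c (row S z₀ i z)) _ (show n = n - 1 + 1 by omega), hK,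
      ← hg, map_smul, hexp, field_add, field_sum, field_smul, LinearMap.add_apply,
      LinearMap.sum_apply, LinearMap.smul_apply, hMc, hk2, map_zero, smul_zero, add_zero,
      Finset.sum_eq_zero, smul_zero]
    intro i hi
    rw [field_smul, LinearMap.smul_apply, hMc, hk1 i (Finset.mem_range.1 hi), map_zero, smul_zero]
  have hβ0 : β = 0 := (mul_eq_zero.1 hαβ).resolve_left hα0
  have hακ : α = κ := by
    rw [hβ0, mul_zero, zero_add] at hone
    field_simp at hone
    exact hone
  refine ⟨fun i => form g (e (Sum.inr (Fin.ofNat n i))), ?_⟩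
  simp only [hcol]
  rw [← hg, ← hκ]
  conv_lhs => rw [hexp, hβ0, zero_smul, add_zero, hακ, add_comm]

theorem row_triangular [FiniteDimensional ℂ H] (R : FockRep n H)
    (hM : Transport U z₀ S.s R.lowH M) (hm : VectorTransport U z₀ S.s m) (hn : 3 ≤ n) (hU : IsOpen U)
    (hUs : StarConvex ℝ z₀ U) {z : ℂ} (hz : z ∈ U) (a : ℕ) (ha : a < n)
    (hdet : a + 1 = n → (Theta S z₀ z).det ≠ 0) :
    ∃ r : ℕ → ℂ, row S z₀ a z
      = rowCoeff S hn a z • col m a z + ∑ j ∈ Finset.range a, r j • col m j z := by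
  by_cases h : a + 1 = n
  · obtain rfl : a = n - 1 := by omega
    exact row_last S R hM hm hn hU hUs hz (hdet h)
  · rw [row_of_lt S (by omega)]
    exact embD_triangular S hm hn hU hUs hz a (by omega)

/-- The exponent relating the state of `Σ^{[p]}`, `p = k + 1`, to the transported highest weight
vector. -/
def weight (k : Fin n) (z : ℂ) : ℂ :=
  if k.val + 3 ≤ n then xi S k z else xi S k z + xi S (lastIdx n) z

theorem prod_rowCoeff_eq_weight (hn : 3 ≤ n) (z : ℂ) (k : Fin n) :
    ∏ i ∈ Finset.range (k.val + 1), rowCoeff S hn i z = Complex.exp (-weight S k z) := by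
  have hk := k.isLt
  have hlast : lastIdx n = ⟨n - 1, by omega⟩ := rfl
  rcases (by omega : k.val + 3 ≤ n ∨ k.val = n - 2 ∨ k.val = n - 1) with h | h | h
  · rw [prod_rowCoeff S hn z _ (by omega), weight, if_pos h, expo, eta, dif_pos (by omega)]
  · rw [prod_rowCoeff S hn z _ (by omega), weight, if_neg (by omega), expo,
      show k.val + 1 = n - 1 by omega, eta_penult hn, hlast,
      show k = ⟨n - 2, by omega⟩ from Fin.ext h]
  · rw [Finset.prod_range_succ, prod_rowCoeff S hn z _ (by omega), weight, if_neg (by omega), expo,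
      h, rowCoeff, if_pos (by omega), eta_penult hn, hlast,
      show k = ⟨n - 1, by omega⟩ from Fin.ext h, ← Complex.exp_add]
    congr 1
    ring

theorem low_eq (k : Fin n) (a : Fin (k.val + 1)) : (Sum.inl (low k a) : Idx n) = pos a.val :=
  (pos_eq (by have := a.isLt; have := k.isLt; omega)).symm

/-- The state built by the rows of the surface `Σ^{[p]}`, `p = k + 1 ≤ n - 2`, is the transported
highest weight vector. -/
theorem ket_surface_cr [FiniteDimensional ℂ H] (R : FockRep n H) {Mh : ℂ → Module.End ℂ H}
    (hM : Transport U z₀ S.s R.lowB M) (hMh : Transport U z₀ S.s R.lowH Mh) (hn : 3 ≤ n)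
    (hU : IsOpen U) (hUs : StarConvex ℝ z₀ U) {z : ℂ} (hz : z ∈ U) (k : Fin n)
    (hdet : k.val + 1 = n → (Theta S z₀ z).det ≠ 0) :
    ket (fun a => field R.cr (surface S z₀ k z a)) R.vac
      = Complex.exp (-weight S k z) • M z (ket (fun a => R.cr (Sum.inl (low k a))) R.vac) := by
  obtain ⟨m, hm⟩ := exists_vectorTransport R hM
  have hs : ∀ j, ContinuousOn (S.s j) U := fun j => (differentiableOn_s S j).continuousOn
  rw [hM.apply_ket hUs hs R.lowB_comm hm hz R.lowB_vac, ← prod_rowCoeff_eq_weight S hn]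
  simp only [low_eq]
  refine ket_triangular (fun i => field R.cr (row S z₀ i z)) (fun i => field R.cr (col m i z)) _ _
    (k.val + 1) (fun i hi => ?_) fun i _ j _ => field_cr_anticomm R _ _
  have hk := k.isLt
  obtain ⟨r, hr⟩ := row_triangular S R hMh hm hn hU hUs hz i (by omega)
    fun h => hdet (by omega)
  refine ⟨r, ?_⟩
  rw [hr, field_add, field_smul, field_sum]
  simp only [field_smul]

/-- The same on the half-spin vacuum. -/
theorem ket_surface_c [FiniteDimensional ℂ H] (R : FockRep n H) {Mh : ℂ → Module.End ℂ H}
    (hM : Transport U z₀ S.s R.lowB M) (hMh : Transport U z₀ S.s R.lowH Mh) (hn : 3 ≤ n)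
    (hU : IsOpen U) (hUs : StarConvex ℝ z₀ U) {z : ℂ} (hz : z ∈ U) (k : Fin n)
    (hdet : k.val + 1 = n → (Theta S z₀ z).det ≠ 0) :
    ket (fun a => field R.c (surface S z₀ k z a)) R.hvac
      = Complex.exp (-weight S k z) • Mh z (ket (fun a => R.c (Sum.inl (low k a))) R.hvac) := by
  obtain ⟨m, hm⟩ := exists_vectorTransport R hM
  have hs : ∀ j, ContinuousOn (S.s j) U := fun j => (differentiableOn_s S j).continuousOn
  rw [hMh.apply_ket hUs hs R.lowH_comm hm hz R.lowH_hvac, ← prod_rowCoeff_eq_weight S hn]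
  simp only [low_eq]
  refine ket_triangular (fun i => field R.c (row S z₀ i z)) (fun i => field R.c (col m i z)) _ _
    (k.val + 1) (fun i hi => ?_) fun i _ j _ => ?_
  · have hk := k.isLt
    obtain ⟨r, hr⟩ := row_triangular S R hMh hm hn hU hUs hz i (by omega)
      fun h => hdet (by omega)
    refine ⟨r, ?_⟩
    rw [hr, field_add, field_smul, field_sum]
    simp only [field_smul]
  · rw [field_c_anticomm, form_col_col S R hMh hUs hm hz, zero_smul]

end Rows

/-! ### Kets and bras -/

section States

variable {n : ℕ}

theorem transport_lowB {U : Set ℂ} {z₀ : ℂ} {s : Fin n → ℂ → ℂ} {M : ℂ → Op n}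
    (h : SolvesRight U z₀ s lowerB M) : Transport U z₀ s (ketRep n).lowB M := h

theorem transport_lowH {U : Set ℂ} {z₀ : ℂ} {s : Fin n → ℂ → ℂ} {M : ℂ → Op n}
    (h : SolvesRight U z₀ s lowerH M) : Transport U z₀ s (ketRep n).lowH M := h

theorem transp_sub (O O' : Op n) : transp (O - O') = transp O - transp O' :=
  map_sub (Module.Dual.transpose (R := ℂ)) O O'

theorem transp_add (O O' : Op n) : transp (O + O') = transp O + transp O' :=
  map_add (Module.Dual.transpose (R := ℂ)) O O'

theorem transp_smul (r : ℂ) (O : Op n) : transp (r • O) = r • transp O :=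
  map_smul (Module.Dual.transpose (R := ℂ)) r O

theorem transp_sum {ι : Type*} (s : Finset ι) (O : ι → Op n) :
    transp (∑ i ∈ s, O i) = ∑ i ∈ s, transp (O i) :=
  map_sum (Module.Dual.transpose (R := ℂ)) O s

theorem transp_mul (O O' : Op n) : transp (O * O') = transp O' * transp O := rfl

theorem transp_cAnn (i : Fin n) : transp (cAnn i) = (braRep n).c (Sum.inl i) := by
  rw [cAnn, transp_smul, transp_add]
  rfl

theorem transp_cCre (i : Fin n) : transp (cCre i) = (braRep n).c (Sum.inr i) := by
  rw [cCre, transp_smul, transp_add]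
  rfl

theorem transp_raiseB (i : Fin n) : transp (raiseB i) = (braRep n).lowB i := by
  unfold raiseB FockRep.lowB
  split_ifs <;> rw [transp_sub] <;> rfl

theorem transp_raiseH (i : Fin n) : transp (raiseH i) = (braRep n).lowH i := by
  unfold raiseH FockRep.lowH
  split_ifs <;> rw [transp_mul] <;> simp only [transp_cAnn, transp_cCre]

/-- Transposition turns `dN/dw = (∑_j s_j E_j) N` into an equation of the form of the one for `M`. -/
theorem transport_transp {V : Set ℂ} {w₀ : ℂ} {s : Fin n → ℂ → ℂ} {E : Fin n → Op n}
    {N : ℂ → Op n} (h : SolvesLeft V w₀ s E N) :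
    Transport V w₀ s (fun j => transp (E j)) fun w => transp (N w) := by
  refine ⟨(congrArg transp h.1).trans rfl, fun w hw φ χ => ?_⟩
  obtain ⟨ψ, rfl⟩ := (Module.evalEquiv ℂ (Fock n)).surjective φ
  refine (h.2 w hw χ ψ).congr_deriv ?_
  simp only [Module.evalEquiv_apply, Module.End.mul_apply, ← transp_smul, ← transp_sum]
  rfl

theorem transport_raiseB {V : Set ℂ} {w₀ : ℂ} {s : Fin n → ℂ → ℂ} {N : ℂ → Op n}
    (h : SolvesLeft V w₀ s raiseB N) :
    Transport V w₀ s (braRep n).lowB fun w => transp (N w) := by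
  have := transport_transp h
  simpa only [transp_raiseB] using this

theorem transport_raiseH {V : Set ℂ} {w₀ : ℂ} {s : Fin n → ℂ → ℂ} {N : ℂ → Op n}
    (h : SolvesLeft V w₀ s raiseH N) :
    Transport V w₀ s (braRep n).lowH fun w => transp (N w) := by
  have := transport_transp h
  simpa only [transp_raiseH] using this

theorem apply_ofFn_prod {p : ℕ} (y : Fin p → Op n) (χ : Module.Dual ℂ (Fock n)) (x : Fock n) :
    χ ((List.ofFn y).prod x) = ket (fun a => transp (y a)) χ x := by
  induction p generalizing x with
  | zero => simp
  | succ p ih =>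
    rw [ket_succ, transp_apply, ← ih, List.ofFn_succ', List.concat_eq_append, List.prod_append,
      List.prod_singleton, Module.End.mul_apply]

variable {H : Type} [AddCommGroup H] [Module ℂ H]

/-- The state `X^p ⋯ X^1` on the vacuum that belongs to `p = k + 1`. -/
def state (R : FockRep n H) (k : Fin n) (X : Fin (k.val + 1) → Idx n → ℂ) : H :=
  if k.val + 3 ≤ n then ket (fun a => field R.cr (X a)) R.vac
  else ket (fun a => field R.c (X a)) R.hvac

/-- The highest weight vector `|λ_p⟩`, `p = k + 1`. -/
def highest (R : FockRep n H) (k : Fin n) : H :=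
  if k.val + 3 ≤ n then ket (fun a => R.cr (Sum.inl (low k a))) R.vac
  else ket (fun a => R.c (Sum.inl (low k a))) R.hvac

theorem vev_eq (O : Op n) : vev O = dualVac n (O 1) := rfl

theorem halfVev_eq (O : Op n) : halfVev O = (braRep n).hvac (O (ketRep n).hvac) := by
  rw [halfVev, vev_eq, Module.End.mul_apply, Module.End.mul_apply]
  exact apply_ofFn_prod _ (dualVac n) _

theorem expPotential_eq (k : Fin n) (X Xb : Fin (k.val + 1) → Idx n → ℂ) :
    expPotential k X Xb = state (braRep n) k Xb (state (ketRep n) k X) := by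
  have h1 : ∀ u, transp (∑ A, u A • ann A : Op n) = field (braRep n).cr u := fun u => by
    rw [transp_sum]
    simp only [transp_smul]
    rfl
  have h2 : ∀ u : Idx n → ℂ, transp (∑ i, (u (Sum.inl i) • cAnn i + u (Sum.inr i) • cCre i) : Op n)
      = field (braRep n).c u := fun u => by
    rw [transp_sum, field, Fintype.sum_sum_type, ← Finset.sum_add_distrib]
    simp only [transp_add, transp_smul, transp_cAnn, transp_cCre]
  have h3 : ∀ u : Idx n → ℂ, (∑ i, (u (Sum.inl i) • cCre i + u (Sum.inr i) • cAnn i) : Op n)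
      = field (ketRep n).c u := fun u => by
    rw [field, Fintype.sum_sum_type, ← Finset.sum_add_distrib]
    rfl
  unfold expPotential state
  split_ifs with h
  · rw [vev_eq, Module.End.mul_apply, apply_ofFn_prod]
    simp only [h1]
    rfl
  · rw [halfVev_eq, Module.End.mul_apply, apply_ofFn_prod]
    simp only [h2, h3]
    rfl

theorem tau_eq (N M Nh Mh : Op n) (k : Fin n) :
    tau N M Nh Mh k = (if k.val + 3 ≤ n then transp N else transp Nh) (highest (braRep n) k)
      ((if k.val + 3 ≤ n then M else Mh) (highest (ketRep n) k)) := by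
  unfold tau highest
  split_ifs with h
  · rw [vev_eq, Module.End.mul_apply, Module.End.mul_apply, Module.End.mul_apply, apply_ofFn_prod]
    rfl
  · rw [halfVev_eq, Module.End.mul_apply, Module.End.mul_apply, Module.End.mul_apply,
      apply_ofFn_prod]
    simp only [transp_cAnn]
    rfl

theorem state_surface [NeZero n] {U : Set ℂ} {z₀ : ℂ} [FiniteDimensional ℂ H] (S : Screening n U)
    (R : FockRep n H) {M Mh : ℂ → Module.End ℂ H} (hM : Transport U z₀ S.s R.lowB M)
    (hMh : Transport U z₀ S.s R.lowH Mh) (hn : 3 ≤ n) (hU : IsOpen U) (hUs : StarConvex ℝ z₀ U)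
    {z : ℂ} (hz : z ∈ U) (k : Fin n) (hdet : k.val + 1 = n → (Theta S z₀ z).det ≠ 0) :
    state R k (surface S z₀ k z)
      = Complex.exp (-weight S k z) • (if k.val + 3 ≤ n then M z else Mh z) (highest R k) := by
  unfold state highest
  split_ifs
  · exact ket_surface_cr S R hM hMh hn hU hUs hz k hdet
  · exact ket_surface_c S R hM hMh hn hU hUs hz k hdet

/-- On the surfaces, `exp 𝒦^{[p]}` is `e^{-Φ_p}` up to a product of chiral factors. -/
theorem expPotential_surface [NeZero n] (hn : 3 ≤ n) {U V : Set ℂ} {z₀ w₀ : ℂ} (hU : IsOpen U)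
    (hV : IsOpen V) (hUs : StarConvex ℝ z₀ U) (hVs : StarConvex ℝ w₀ V) (S : Screening n U)
    (T : Screening n V) {W : Set (ℂ × ℂ)} (hWUV : W ⊆ U ×ˢ V) {Φ : Fin n → ℂ → ℂ → ℂ}
    (hΦ : IsTodaFields S T z₀ w₀ W Φ) (k : Fin n) {z w : ℂ} (hzw : (z, w) ∈ W)
    (hdet : k.val + 1 = n → (Theta S z₀ z).det ≠ 0 ∧ (Theta T w₀ w).det ≠ 0) :
    expPotential k (surface S z₀ k z) (surface T w₀ k w)
      = Complex.exp (-Φ k z w + (xi S k z - weight S k z) + (xi T k w - weight T k w)) := by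
  obtain ⟨-, M, Mh, N, Nh, hM, hMh, hN, hNh, hexp⟩ := hΦ
  rw [expPotential_eq, state_surface S (ketRep n) (transport_lowB hM) (transport_lowH hMh) hn hU hUs
      (hWUV hzw).1 k fun h => (hdet h).1,
    state_surface T (braRep n) (transport_raiseB hN) (transport_raiseH hNh) hn hV hVs (hWUV hzw).2 k
      fun h => (hdet h).2, LinearMap.smul_apply, map_smul, ← tau_eq, smul_eq_mul, smul_eq_mul]
  rw [show -Φ k z w + (xi S k z - weight S k z) + (xi T k w - weight T k w)
    = -Φ k z w + (-weight T k w + (-weight S k z + (xi T k w + xi S k z))) by ring, Complex.exp_add,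
    hexp k z w hzw, Complex.exp_add (-weight T k w), Complex.exp_add (-weight S k z)]
  have e : Complex.exp (-xi T k w - xi S k z) * Complex.exp (xi T k w + xi S k z) = 1 := by
    rw [← Complex.exp_add, ← Complex.exp_zero]
    congr 1
    ring
  linear_combination -(tau (N w) (M z) (Nh w) (Mh z) k * Complex.exp (-weight T k w)
    * Complex.exp (-weight S k z)) * e

end States

/-! ### Pullback of the Kähler metric -/

section Metric

/-- The matrix elements of a product of fields are polynomials in the coefficients. -/
theorem differentiable_apply_ket {n : ℕ} {H : Type} [AddCommGroup H] [Module ℂ H]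
    {E : Type*} [NormedAddCommGroup E] [NormedSpace ℂ E] (a : Idx n → Module.End ℂ H) (v : H)
    {p : ℕ} (u : Fin p → E → Idx n → ℂ) (hu : ∀ i A, Differentiable ℂ fun X => u i X A)
    (φ : Module.Dual ℂ H) : Differentiable ℂ fun X => φ (ket (fun i => field a (u i X)) v) := by
  induction p generalizing φ with
  | zero => simp
  | succ p ih =>
    simp only [ket_succ, field, LinearMap.sum_apply, LinearMap.smul_apply, map_sum, map_smul,
      smul_eq_mul]
    exact Differentiable.fun_sum fun A _ => (hu _ A).mul
      (ih (fun i => u i.castSucc) (fun i A => hu _ A) (φ ∘ₗ a A))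

theorem differentiable_apply_state {n : ℕ} {H : Type} [AddCommGroup H] [Module ℂ H]
    (R : FockRep n H) (k : Fin n) (φ : Module.Dual ℂ H) :
    Differentiable ℂ fun X : Fin (k.val + 1) → Idx n → ℂ => φ (state R k X) := by
  have hu : ∀ (a : Fin (k.val + 1)) (A : Idx n),
      Differentiable ℂ fun X : Fin (k.val + 1) → Idx n → ℂ => X a A := fun a A => by fun_prop
  unfold state
  split_ifs
  · exact differentiable_apply_ket (E := Fin (k.val + 1) → Idx n → ℂ) R.cr R.vac
      (fun a X => X a) hu φ
  · exact differentiable_apply_ket (E := Fin (k.val + 1) → Idx n → ℂ) R.c R.hvac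
      (fun a X => X a) hu φ

/-- If the potential is a finite sum of products of holomorphic and antiholomorphic functions, its
metric pulls back to a curve as the mixed derivative of the logarithm of the restriction. -/
theorem kahlerMetric_pullback {ι E : Type*} [Fintype ι] [NormedAddCommGroup E] [NormedSpace ℂ E]
    (P : E → E → ℂ) (B K : ι → E → ℂ) (hB : ∀ i, Differentiable ℂ (B i))
    (hK : ∀ i, Differentiable ℂ (K i)) (hP : ∀ X Xb, P X Xb = ∑ i, B i Xb * K i X)
    {x y : ℂ → E} {z w : ℂ} (hx : DifferentiableAt ℂ x z) (hy : DifferentiableAt ℂ y w)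
    (h0 : P (x z) (y w) ≠ 0) :
    kahlerMetric P (x z) (y w) (deriv x z) (deriv y w)
      = deriv (fun ζ => logDeriv (fun ω => P (x ζ) (y ω)) w) z := by
  let Q : E → ℂ := fun X => (∑ i, fderiv ℂ (B i) (y w) (deriv y w) * K i X) / P X (y w)
  have hline : ∀ (a v : E), HasDerivAt (fun t : ℂ => a + t • v) v 0 := fun a v => by
    simpa using ((hasDerivAt_id (0 : ℂ)).smul_const v).const_add a
  have h1 : ∀ X, logDeriv (fun r : ℂ => P X (y w + r • deriv y w)) 0 = Q X := by
    intro X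
    have hd : HasDerivAt (fun r : ℂ => P X (y w + r • deriv y w))
        (∑ i, fderiv ℂ (B i) (y w) (deriv y w) * K i X) 0 := by
      simp only [hP]
      exact HasDerivAt.fun_sum fun i _ => ((hB i _).hasFDerivAt.comp_hasDerivAt_of_eq (0 : ℂ)
        (hline (y w) (deriv y w)) (by simp)).mul_const _
    rw [logDeriv_apply, hd.deriv]
    simp [Q]
  have h2 : ∀ X, logDeriv (fun ω => P X (y ω)) w = Q X := by
    intro X
    have hd : HasDerivAt (fun ω => P X (y ω))
        (∑ i, fderiv ℂ (B i) (y w) (deriv y w) * K i X) w := by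
      simp only [hP]
      exact HasDerivAt.fun_sum fun i _ =>
        ((hB i _).hasFDerivAt.comp_hasDerivAt w hy.hasDerivAt).mul_const _
    rw [logDeriv_apply, hd.deriv]
  have hQ : DifferentiableAt ℂ Q (x z) := by
    simp only [Q, div_eq_mul_inv]
    refine DifferentiableAt.fun_mul ?_ (DifferentiableAt.fun_inv ?_ h0)
    · exact DifferentiableAt.fun_sum fun i _ => (hK i _).const_mul _
    · simp only [hP]
      exact DifferentiableAt.fun_sum fun i _ => (hK i _).const_mul _
  unfold kahlerMetric
  simp only [h1, h2]
  exact ((hQ.hasFDerivAt.comp_hasDerivAt_of_eq (0 : ℂ) (hline (x z) (deriv x z)) (by simp)).deriv).trans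
    (hQ.hasFDerivAt.comp_hasDerivAt z hx.hasDerivAt).deriv.symm

theorem differentiableAt_det {ι : Type*} [Fintype ι] [DecidableEq ι] {A : ℂ → Matrix ι ι ℂ} {z : ℂ}
    (hA : ∀ i j, DifferentiableAt ℂ (fun ζ => A ζ i j) z) :
    DifferentiableAt ℂ (fun ζ => (A ζ).det) z := by
  simp only [Matrix.det_apply]
  exact DifferentiableAt.fun_sum fun σ _ =>
    (DifferentiableAt.fun_finsetProd fun i _ => hA _ _).const_smul _

theorem differentiableAt_inv {ι : Type*} [Fintype ι] [DecidableEq ι] {A : ℂ → Matrix ι ι ℂ} {z : ℂ}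
    (hA : ∀ i j, DifferentiableAt ℂ (fun ζ => A ζ i j) z) (h0 : (A z).det ≠ 0) (i j : ι) :
    DifferentiableAt ℂ (fun ζ => (A ζ)⁻¹ i j) z := by
  simp only [Matrix.inv_def, Ring.inverse_eq_inv', Matrix.smul_apply, smul_eq_mul,
    Matrix.adjugate_apply]
  refine ((differentiableAt_det hA).inv h0).mul (differentiableAt_det fun k l => ?_)
  simp only [Matrix.updateRow_apply]
  split_ifs
  · exact differentiableAt_const _
  · exact hA k l

variable {n : ℕ} [NeZero n] {U : Set ℂ} {z₀ : ℂ} (S : Screening n U)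

theorem differentiableAt_iteratedDeriv_emb (hU : IsOpen U) (hUs : StarConvex ℝ z₀ U) {z : ℂ}
    (hz : z ∈ U) (j : ℕ) (A : Idx n) : DifferentiableAt ℂ (iteratedDeriv j (emb S z₀ A)) z :=
  (differentiableOn_iteratedDeriv hU (differentiableOn_emb S hU hUs A) j).differentiableAt
    (hU.mem_nhds hz)

theorem differentiableAt_Theta (hU : IsOpen U) (hUs : StarConvex ℝ z₀ U) {z : ℂ} (hz : z ∈ U)
    (p q : Fin n) : DifferentiableAt ℂ (fun ζ => Theta S z₀ ζ p q) z := by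
  simp only [Theta, Matrix.of_apply]
  exact DifferentiableAt.fun_sum fun _ _ =>
    (differentiableAt_iteratedDeriv_emb S hU hUs hz _ _).fun_mul
      (differentiableAt_iteratedDeriv_emb S hU hUs hz _ _)

theorem differentiableAt_surface (hU : IsOpen U) (hUs : StarConvex ℝ z₀ U) {z : ℂ} (hz : z ∈ U)
    (k : Fin n) (hdet : k.val + 1 = n → (Theta S z₀ z).det ≠ 0) :
    DifferentiableAt ℂ (surface S z₀ k) z := by
  rw [differentiableAt_pi]
  intro a
  rw [differentiableAt_pi]
  intro A
  unfold surface
  refine (differentiableAt_iteratedDeriv_emb S hU hUs hz _ _).sub ?_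
  split_ifs with h
  · rcases A with i | i
    · exact differentiableAt_const _
    · have hk : k.val + 1 = n := by have := a.isLt; have := k.isLt; omega
      exact DifferentiableAt.fun_sum fun q _ =>
        (differentiableAt_inv (differentiableAt_Theta S hU hUs hz) (hdet hk) _ _).mul
          (differentiableAt_iteratedDeriv_emb S hU hUs hz _ _)
  · exact differentiableAt_const _

theorem eventually_det_ne_zero (hU : IsOpen U) (hUs : StarConvex ℝ z₀ U) {z : ℂ} (hz : z ∈ U)
    (k : Fin n) (hdet : k.val + 1 = n → (Theta S z₀ z).det ≠ 0) :
    ∀ᶠ ζ in nhds z, k.val + 1 = n → (Theta S z₀ ζ).det ≠ 0 := by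
  by_cases h : k.val + 1 = n
  · exact ((differentiableAt_det (differentiableAt_Theta S hU hUs hz)).continuousAt.eventually_ne
      (hdet h)).mono fun ζ hζ _ => hζ
  · exact Filter.Eventually.of_forall fun ζ h' => absurd h' h

/-- Chiral terms do not change the metric. -/
theorem mixedDeriv_add_chiral {W : Set (ℂ × ℂ)} (hW : IsOpen W) {F : ℂ → ℂ → ℂ} {a b : ℂ → ℂ}
    (hF : DifferentiableOn ℂ (fun q : ℂ × ℂ => F q.1 q.2) W) {z w : ℂ} (hzw : (z, w) ∈ W)
    (hb : DifferentiableAt ℂ b w) :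
    mixedDeriv (fun ζ ω => F ζ ω + a ζ + b ω) z w = mixedDeriv F z w := by
  unfold mixedDeriv
  have h1 : ∀ᶠ ζ in nhds z, deriv (fun ω => F ζ ω + a ζ + b ω) w
      = deriv (fun ω => F ζ ω) w + deriv b w := by
    have hc : ContinuousAt (fun ζ : ℂ => (ζ, w)) z := by fun_prop
    filter_upwards [hc.preimage_mem_nhds (hW.mem_nhds hzw)] with ζ hζ
    have h2 : DifferentiableAt ℂ (fun ω => F ζ ω) w :=
      DifferentiableAt.comp (g := fun q : ℂ × ℂ => F q.1 q.2) (f := fun ω : ℂ => (ζ, ω)) w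
        (hF.differentiableAt (hW.mem_nhds hζ)) (by fun_prop)
    exact ((h2.hasDerivAt.add_const (a ζ)).add hb.hasDerivAt).deriv
  rw [Filter.EventuallyEq.deriv_eq h1, deriv_add_const]

theorem logDeriv_cexp_comp {f g : ℂ → ℂ} {w : ℂ} (h : f =ᶠ[nhds w] fun ω => Complex.exp (g ω))
    (hg : DifferentiableAt ℂ g w) : logDeriv f w = deriv g w := by
  rw [logDeriv_apply, h.deriv_eq, h.eq_of_nhds, hg.hasDerivAt.cexp.deriv,
    mul_div_cancel_left₀ _ (Complex.exp_ne_zero _)]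

end Metric

end DToda

end

open DToda
theorem corollary1 (n : ℕ) [NeZero n] (hn : 3 ≤ n)
    (U V : Set ℂ) (hU : IsOpen U) (hV : IsOpen V) (z₀ w₀ : ℂ) (hz₀ : z₀ ∈ U) (hw₀ : w₀ ∈ V)
    (hUs : StarConvex ℝ z₀ U) (hVs : StarConvex ℝ w₀ V)
    -- the screening functions `s_j(z)` and `s̄_j(z̄)`, with `w` in place of `z̄`
    (S : Screening n U) (T : Screening n V)
    -- the Toda fields `Φ_1, …, Φ_n` with these screening functions
    (W : Set (ℂ × ℂ)) (hW : IsOpen W) (hWUV : W ⊆ U ×ˢ V)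
    (Φ : Fin n → ℂ → ℂ → ℂ) (hΦ : IsTodaFields S T z₀ w₀ W Φ) :
    ∀ (k : Fin n) (z w : ℂ), (z, w) ∈ W →
      (k.val + 1 = n → (Theta S z₀ z).det ≠ 0 ∧ (Theta T w₀ w).det ≠ 0) →
      -- the intrinsic metric of `Σ^{[p]}`, `p = k + 1`, has the Kähler potential `-Φ_p`
      intrinsicMetric S T z₀ w₀ k z w = mixedDeriv (fun ζ ω => -Φ k ζ ω) z w ∧
      -- `𝒦^{[p]} = -Φ_p` on the surface for `p ≤ n - 2`
      (k.val + 3 ≤ n →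
        expPotential k (surface S z₀ k z) (surface T w₀ k w) = Complex.exp (-Φ k z w)) ∧
      -- `𝒦^{[p]} = -(Φ_p + ξ_n + ξ̄_n)` for `p = n - 1, n`; the chiral terms do not change the metric
      (n < k.val + 3 →
        expPotential k (surface S z₀ k z) (surface T w₀ k w)
            = Complex.exp (-(Φ k z w + xi S (lastIdx n) z + xi T (lastIdx n) w)) ∧
        mixedDeriv (fun ζ ω => -(Φ k ζ ω + xi S (lastIdx n) ζ + xi T (lastIdx n) ω)) z w
            = mixedDeriv (fun ζ ω => -Φ k ζ ω) z w) := by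
  intro k z w hzw hdet
  have hz : z ∈ U := (hWUV hzw).1
  have hw : w ∈ V := (hWUV hzw).2
  have hΦd : DifferentiableOn ℂ (fun q : ℂ × ℂ => -Φ k q.1 q.2) W := (hΦ.1 k).neg
  have hexp := fun ζ ω (h : (ζ, ω) ∈ W) hd =>
    expPotential_surface hn hU hV hUs hVs S T hWUV hΦ k (z := ζ) (w := ω) h hd
  have hxi : ∀ j, DifferentiableAt ℂ (xi T j) w := fun j =>
    (differentiableOn_xi T j).differentiableAt (hV.mem_nhds hw)
  have hb : DifferentiableAt ℂ (fun ω => xi T k ω - weight T k ω) w := by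
    refine (hxi k).sub ?_
    unfold weight
    split_ifs
    · exact hxi k
    · exact (hxi k).add (hxi _)
  refine ⟨?_, fun hk => ?_, fun hk => ⟨?_, ?_⟩⟩
  · let b := Module.finBasis ℂ (Fock n)
    have h0 : expPotential k (surface S z₀ k z) (surface T w₀ k w) ≠ 0 := by
      rw [hexp z w hzw hdet]
      exact Complex.exp_ne_zero _
    rw [intrinsicMetric, kahlerMetric_pullback (expPotential k)
      (fun i Xb => state (braRep n) k Xb (b i)) (fun i X => b.coord i (state (ketRep n) k X))
      (fun i => differentiable_apply_state (braRep n) k (Module.Dual.eval ℂ _ (b i)))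
      (fun i => differentiable_apply_state (ketRep n) k (b.coord i)) (fun X Xb => ?_)
      (differentiableAt_surface S hU hUs hz k fun h => (hdet h).1)
      (differentiableAt_surface T hV hVs hw k fun h => (hdet h).2) h0]
    · rw [← mixedDeriv_add_chiral hW hΦd hzw hb (a := fun ζ => xi S k ζ - weight S k ζ), mixedDeriv]
      refine Filter.EventuallyEq.deriv_eq ?_
      have hc : ContinuousAt (fun ζ : ℂ => (ζ, w)) z := by fun_prop
      filter_upwards [hc.preimage_mem_nhds (hW.mem_nhds hzw),
        eventually_det_ne_zero S hU hUs hz k fun h => (hdet h).1] with ζ hζ hdζ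
      refine logDeriv_cexp_comp ?_ ?_
      · have hc' : ContinuousAt (fun ω : ℂ => (ζ, ω)) w := by fun_prop
        filter_upwards [hc'.preimage_mem_nhds (hW.mem_nhds hζ),
          eventually_det_ne_zero T hV hVs hw k fun h => (hdet h).2] with ω hω hdω
        exact hexp ζ ω hω fun h => ⟨hdζ h, hdω h⟩
      · refine DifferentiableAt.fun_add (DifferentiableAt.add_const _ ?_) hb
        exact DifferentiableAt.comp (g := fun q : ℂ × ℂ => -Φ k q.1 q.2)
          (f := fun ω : ℂ => (ζ, ω)) w (hΦd.differentiableAt (hW.mem_nhds hζ)) (by fun_prop)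
    · rw [expPotential_eq]
      conv_lhs => rw [← b.sum_repr (state (ketRep n) k X)]
      rw [map_sum]
      refine Finset.sum_congr rfl fun i _ => ?_
      rw [map_smul, smul_eq_mul, mul_comm]
      rfl
  · rw [hexp z w hzw hdet, weight, weight, if_pos hk, if_pos hk, sub_self, sub_self, add_zero,
      add_zero]
  · rw [hexp z w hzw hdet, weight, weight, if_neg (by omega), if_neg (by omega)]
    congr 1
    ring
  · rw [← mixedDeriv_add_chiral (F := fun ζ ω => -Φ k ζ ω) hW hΦd hzw
      (hxi (lastIdx n)).neg
      (a := fun ζ => -xi S (lastIdx n) ζ)]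
    congr 1
    funext ζ ω
    simp only [Pi.neg_apply]
    ring
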